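/- **Theorem (Small loss guarantees optimal entropy dissipation).** Let $T>0$, let $\pi$ be a strictly positive $C^1$ probability density on $\mathbb R^d$, and let $s_t(x)\in\mathbb R^d$, $(t,x)\in[0,T]\times\mathbb R^d$, be any time-dependent vector field, measurable in $x$ and continuous in $t$. Let $(X_t)_{t\in[0,T]}$ be random vectors in $\mathbb R^d$ on a probability space such that, almost surely, $$\frac{\mathrm d X_t}{\mathrm d t}=\nabla\log\pi(X_t)-s_t(X_t)\qquad\text{for all } t\in[0,T],$$ and suppose that the law of $X_t$ has a probability density $f_t$ for every $t\in[0,T]$ (in particular $X_0\sim f_0$), where $(t,x)\mapsto f_t(x)$ is $C^1$ on $[0,T]\times\mathbb R^d$. Set $$\mathrm{KL}(f_t\|\pi)=\mathbb E_{f_t}\log\tfrac{f_t}{\pi},\qquad F(f_t\|\pi)=\mathbb E_{f_t}\Big\|\nabla\log\tfrac{f_t}{\pi}\Big\|^2,\qquad L(s_t,f_t)=\mathbb E_{f_t}\|s_t-\nabla\log f_t\|^2 .$$ Assume that $\log\frac{f_0}{\pi}$ is $f_0$-integrable and that $F(f_t\|\pi)$ and $L(s_t,f_t)$ are finite and continuous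 in $t\in[0,T]$. Then for every $t\in[0,T]$ the relative entropy $\mathrm{KL}(f_t\|\pi)$ is finite and differentiable in $t$ (one-sidedly at the endpoints), the expectation of the inner product below is that of an $f_t$-integrable function, and $$-\frac{\mathrm d}{\mathrm d t}\mathrm{KL}(f_t\|\pi)=F(f_t\|\pi)-\mathbb E_{f_t}\Big\langle \nabla\log f_t-s_t,\ \nabla\log\tfrac{f_t}{\pi}\Big\rangle\ \ge\ \tfrac12F(f_t\|\pi)-\tfrac12L(s_t,f_t).$$ In particular, for every $t\in[0,T]$ with $L(s_t,f_t)\le\frac12F(f_t\|\pi)$, $$-\frac{\mathrm d}{\mathrm d t}\mathrm{KL}(f_t\|\pi)\ge\tfrac14F(f_t\|\pi).$$ -/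

import Mathlib

namespace ScoreDynamics

open MeasureTheory

/-- The measure `p(x) dx` on `ℝᵈ` with Lebesgue density `p`. -/
noncomputable def densMeasure {d : ℕ} (p : EuclideanSpace ℝ (Fin d) → ℝ) :
    Measure (EuclideanSpace ℝ (Fin d)) :=
  (volume : Measure (EuclideanSpace ℝ (Fin d))).withDensity (fun x => ENNReal.ofReal (p x))

/-- `p` is a probability density on `ℝᵈ`. -/
def IsProbDensity {d : ℕ} (p : EuclideanSpace ℝ (Fin d) → ℝ) : Prop :=
  (∀ x, 0 ≤ p x) ∧ Integrable p ∧ ∫ x, p x = 1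

/-- The score `∇ log p`. It is meaningful at points where `p` is positive and differentiable. -/
noncomputable def score {d : ℕ} (p : EuclideanSpace ℝ (Fin d) → ℝ)
    (x : EuclideanSpace ℝ (Fin d)) : EuclideanSpace ℝ (Fin d) :=
  gradient (fun y => Real.log (p y)) x

/-- The relative score `∇ log (f / π)`. -/
noncomputable def relScore {d : ℕ} (f π : EuclideanSpace ℝ (Fin d) → ℝ)
    (x : EuclideanSpace ℝ (Fin d)) : EuclideanSpace ℝ (Fin d) :=
  gradient (fun y => Real.log (f y / π y)) x

/-- The relative entropy `KL(f ‖ π) = E_f [log (f / π)]`. -/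
noncomputable def relEntropy {d : ℕ} (f π : EuclideanSpace ℝ (Fin d) → ℝ) : ℝ :=
  ∫ x, Real.log (f x / π x) ∂(densMeasure f)

/-- The relative Fisher information `F(f ‖ π) = E_f ‖∇ log (f / π)‖²`. -/
noncomputable def relFisher {d : ℕ} (f π : EuclideanSpace ℝ (Fin d) → ℝ) : ℝ :=
  ∫ x, ‖relScore f π x‖ ^ 2 ∂(densMeasure f)

/-- The score-matching loss `L(s, f) = E_f ‖s - ∇ log f‖²`. -/
noncomputable def scoreLoss {d : ℕ} (s : EuclideanSpace ℝ (Fin d) → EuclideanSpace ℝ (Fin d))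
    (f : EuclideanSpace ℝ (Fin d) → ℝ) : ℝ :=
  ∫ x, ‖s x - score f x‖ ^ 2 ∂(densMeasure f)

end ScoreDynamics

namespace ScoreDynamics

open MeasureTheory Filter Topology

/-! Write `h = f / π` and let `b = ∇log π - s` be the velocity, so that `KL(f_t ‖ π) = E log
h_t(X_t)`. Along a trajectory, formally, `d/dt log h_t(X_t) = (∂_t h_t / h_t)(X_t) + ⟨∇log h_t,
b_t⟩(X_t)`. Since `X_t` has density `π h_t`, the first term has mean `∫ π ∂_t h_t`, the derivative
of the total mass, which is zero. Since `b = (∇log f - s) - ∇log h`, the second has mean `E⟨∇log f -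
s, ∇log h⟩ - F`. This is the claimed formula, and Young's inequality bounds the pairing by `L/2 +
F/2`. The chain rule along trajectories takes the place of the continuity equation.

The work lies in justifying this although `h` may vanish and nothing is assumed about decay at
infinity. The logarithm is replaced by the bounded `truncLog δ` and multiplied by a compactly
supported cutoff `χ`. Integrating over time and trajectories gives the exact identity
`integral_test_sub`, and `entropy_balance` lets `δ → 0` and `χ → 1` together: the time term is an
integral of increments of `truncLogPrim δ (h)`, and `truncLogPrim δ y → y`, so its limit is a
difference of total masses; the cutoff term is at most of order `log(1/δ) ‖∇χ‖`, which vanishes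
because the cutoff radius grows fast enough; the score term is dominated by `‖∇log h‖² + ‖b‖²`,
because `|y * truncLogDeriv δ y| ≤ 1`. Integrability of `log h_t` is a conclusion, obtained from
Fatou's lemma and the bound of the negative part by `π`.

The balance has integral form. To differentiate it at every time, the rate must be continuous. This
follows from continuity of `F` and `L` alone: pointwise convergence together with convergence of
`L²` norms gives convergence of pairings (`tendsto_integral_inner_of_tendsto_integral_norm_sq`). -/

/-- A bounded `C¹` approximation of the logarithm on `[0, ∞)`. -/
noncomputable def truncLog (δ y : ℝ) : ℝ := Real.log (y + δ) - Real.log (1 + δ * y)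

/-- The derivative of `truncLog δ`. -/
noncomputable def truncLogDeriv (δ y : ℝ) : ℝ := 1 / (y + δ) - δ / (1 + δ * y)

/-- The primitive of `y * truncLogDeriv δ y` that vanishes at `0`. -/
noncomputable def truncLogPrim (δ y : ℝ) : ℝ :=
  Real.log (1 + δ * y) / δ - δ * (Real.log (y + δ) - Real.log δ)

/-! ### Scalar estimates for the truncated logarithm. -/

section Scalar

variable {δ y : ℝ}

lemma hasDerivAt_truncLog (hδ : 0 < δ) (hy : 0 ≤ y) :
    HasDerivAt (truncLog δ) (truncLogDeriv δ y) y := by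
  have h1 : HasDerivAt (fun z : ℝ => z + δ) 1 y := (hasDerivAt_id y).add_const δ
  have h2 : HasDerivAt (fun z : ℝ => 1 + δ * z) δ y := by
    simpa using ((hasDerivAt_id y).const_mul δ).const_add 1
  exact (h1.log (by positivity)).sub (h2.log (by positivity))

lemma hasDerivAt_truncLogPrim (hδ : 0 < δ) (hy : 0 ≤ y) :
    HasDerivAt (truncLogPrim δ) (y * truncLogDeriv δ y) y := by
  have h1 : HasDerivAt (fun z : ℝ => z + δ) 1 y := (hasDerivAt_id y).add_const δ
  have h2 : HasDerivAt (fun z : ℝ => 1 + δ * z) δ y := by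
    simpa using ((hasDerivAt_id y).const_mul δ).const_add 1
  refine (((h2.log (by positivity)).div_const δ).sub
    (((h1.log (by positivity)).sub_const (Real.log δ)).const_mul δ)).congr_deriv ?_
  have : 0 < y + δ := by positivity
  have : 0 < 1 + δ * y := by positivity
  unfold truncLogDeriv
  field_simp
  ring

lemma mul_truncLogDeriv_eq (hδ : 0 < δ) (hy : 0 ≤ y) :
    y * truncLogDeriv δ y = 1 / (1 + δ * y) - δ / (y + δ) := by
  have : 0 < y + δ := by positivity
  have : 0 < 1 + δ * y := by positivity
  unfold truncLogDeriv
  field_simp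
  ring

/-- A difference of two numbers in `[0, 1]`. This bound, uniform in `δ`, is what dominates the score
term. -/
lemma abs_mul_truncLogDeriv_le (hδ : 0 < δ) (hy : 0 ≤ y) :
    |y * truncLogDeriv δ y| ≤ 1 := by
  rw [mul_truncLogDeriv_eq hδ hy]
  have h1 : 0 < 1 + δ * y := by positivity
  have h2 : 0 < y + δ := by positivity
  have h3 : 1 / (1 + δ * y) ≤ 1 := by rw [div_le_one h1]; nlinarith
  have h4 : δ / (y + δ) ≤ 1 := by rw [div_le_one h2]; linarith
  have h5 : 0 ≤ 1 / (1 + δ * y) := by positivity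
  have h6 : 0 ≤ δ / (y + δ) := by positivity
  rw [abs_le]
  constructor <;> linarith

/-- Each of the two logarithmic terms lies in `[0, y]`, by `log z ≤ z - 1`. The bound makes the
densities themselves dominate the time term. -/
lemma abs_truncLogPrim_le (hδ : 0 < δ) (hy : 0 ≤ y) : |truncLogPrim δ y| ≤ 2 * y := by
  have h1 : 0 < 1 + δ * y := by positivity
  have h2 : 0 < y + δ := by positivity
  have h3 : Real.log (1 + δ * y) / δ ≤ y := by
    rw [div_le_iff₀ hδ]
    linarith [Real.log_le_sub_one_of_pos h1]
  have h4 : 0 ≤ Real.log (1 + δ * y) / δ :=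
    div_nonneg (Real.log_nonneg (by nlinarith)) hδ.le
  have h5 : δ * (Real.log (y + δ) - Real.log δ) ≤ y := by
    rw [← Real.log_div h2.ne' hδ.ne']
    have := Real.log_le_sub_one_of_pos (div_pos h2 hδ)
    calc _ ≤ δ * ((y + δ) / δ - 1) := by gcongr
      _ = y := by field_simp; ring
  have h6 : 0 ≤ δ * (Real.log (y + δ) - Real.log δ) :=
    mul_nonneg hδ.le (sub_nonneg.2 (Real.log_le_log hδ (by linarith)))
  unfold truncLogPrim
  rw [abs_le]
  constructor <;> linarith

/-- `truncLog δ` is the logarithm of the Möbius map `y ↦ (y + δ) / (1 + δ y)`, which sends `[0, ∞)`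
into `[δ, 1/δ]`. -/
lemma abs_truncLog_le_neg_log (hδ : 0 < δ) (hδ1 : δ < 1) (hy : 0 ≤ y) :
    |truncLog δ y| ≤ -Real.log δ := by
  have h1 : 0 < 1 + δ * y := by positivity
  have h2 : 0 < y + δ := by positivity
  unfold truncLog
  rw [abs_le]
  constructor
  · have := Real.log_le_log (mul_pos hδ h1) (show δ * (1 + δ * y) ≤ y + δ by
      nlinarith [mul_nonneg hy (show (0:ℝ) ≤ 1 - δ * δ by nlinarith)])
    rw [Real.log_mul hδ.ne' h1.ne'] at this
    linarith
  · have := Real.log_le_log (mul_pos hδ h2) (show δ * (y + δ) ≤ 1 + δ * y by nlinarith)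
    rw [Real.log_mul hδ.ne' h2.ne'] at this
    linarith

/-- The same Möbius map fixes `1` and moves every other `y > 0` towards `1`. Hence truncation is
dominated by `|log y|` and does not enlarge the negative part. -/
lemma truncLog_mem_uIcc (hδ : 0 < δ) (hδ1 : δ < 1) (hy : 0 < y) :
    truncLog δ y ∈ Set.uIcc 0 (Real.log y) := by
  have h1 : 0 < 1 + δ * y := by positivity
  have h2 : 0 < y + δ := by positivity
  unfold truncLog
  rw [Set.mem_uIcc]
  rcases le_total 1 y with h | h
  · left
    constructor
    · exact sub_nonneg.2 (Real.log_le_log h1 (by nlinarith))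
    · rw [sub_le_iff_le_add, ← Real.log_mul hy.ne' h1.ne']
      exact Real.log_le_log h2 (by nlinarith [mul_nonneg hδ.le (show 0 ≤ y * y - 1 by nlinarith)])
  · right
    constructor
    · rw [le_sub_iff_add_le, ← Real.log_mul hy.ne' h1.ne']
      exact Real.log_le_log (mul_pos hy h1)
        (by nlinarith [mul_nonneg hδ.le (show 0 ≤ 1 - y * y by nlinarith)])
    · exact sub_nonpos.2 (Real.log_le_log h2 (by nlinarith))

variable {ι : Type*} {l : Filter ι} {u : ι → ℝ}

lemma tendsto_truncLog (hy : 0 < y) (hu : Tendsto u l (𝓝 0)) :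
    Tendsto (fun i => truncLog (u i) y) l (𝓝 (Real.log y)) := by
  have h1 : Tendsto (fun i => Real.log (y + u i)) l (𝓝 (Real.log (y + 0))) :=
    (tendsto_const_nhds.add hu).log (by simpa using hy.ne')
  have h2 : Tendsto (fun i => Real.log (1 + u i * y)) l (𝓝 (Real.log (1 + 0 * y))) :=
    (tendsto_const_nhds.add (hu.mul_const y)).log (by simp)
  simpa [truncLog] using h1.sub h2

lemma tendsto_mul_truncLogDeriv (hy : 0 < y) (hu : Tendsto u l (𝓝 0)) :
    Tendsto (fun i => y * truncLogDeriv (u i) y) l (𝓝 1) := by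
  have h1 : Tendsto (fun i => 1 / (y + u i)) l (𝓝 (1 / (y + 0))) :=
    tendsto_const_nhds.div (tendsto_const_nhds.add hu) (by simpa using hy.ne')
  have h2 : Tendsto (fun i => u i / (1 + u i * y)) l (𝓝 (0 / (1 + 0 * y))) :=
    hu.div (tendsto_const_nhds.add (hu.mul_const y)) (by simp)
  have := (h1.sub h2).const_mul y
  simpa [hy.ne', truncLogDeriv] using this

lemma tendsto_truncLogPrim (hy : 0 ≤ y) (hu : Tendsto u l (𝓝 0)) (hpos : ∀ i, 0 < u i) :
    Tendsto (fun i => truncLogPrim (u i) y) l (𝓝 y) := by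
  rcases hy.eq_or_lt with rfl | hy'
  · simpa [truncLogPrim] using tendsto_const_nhds
  have h1 : Tendsto (fun i => Real.log (1 + u i * y) / u i) l (𝓝 y) := by
    -- Squeeze from `1 - 1/z ≤ log z ≤ z - 1` at `z = 1 + δ y`.
    refine tendsto_of_tendsto_of_tendsto_of_le_of_le (g := fun i => y / (1 + u i * y))
      (h := fun _ => y) ?_ tendsto_const_nhds (fun i => ?_) (fun i => ?_)
    · have : Tendsto (fun i => y / (1 + u i * y)) l (𝓝 (y / (1 + 0 * y))) :=
        tendsto_const_nhds.div (tendsto_const_nhds.add (hu.mul_const y)) (by simp)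
      simpa using this
    · have h : 0 < 1 + u i * y := by have := hpos i; positivity
      have := Real.one_sub_inv_le_log_of_pos h
      show y / (1 + u i * y) ≤ Real.log (1 + u i * y) / u i
      rw [le_div_iff₀ (hpos i)]
      refine le_trans (le_of_eq ?_) this
      have : 1 + u i * y ≠ 0 := h.ne'
      rw [eq_sub_iff_add_eq, ← one_div, div_mul_eq_mul_div, ← add_div, div_eq_one_iff_eq this]
      ring
    · have h : 0 < 1 + u i * y := by have := hpos i; positivity
      show Real.log (1 + u i * y) / u i ≤ y
      rw [div_le_iff₀ (hpos i)]
      linarith [Real.log_le_sub_one_of_pos h]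
  have h2 : Tendsto (fun i => u i * Real.log (y + u i)) l (𝓝 (0 * Real.log (y + 0))) :=
    hu.mul ((tendsto_const_nhds.add hu).log (by simpa using hy'.ne'))
  -- `x log x` is continuous at `0`, with value `0`.
  have h3 : Tendsto (fun i => u i * Real.log (u i)) l (𝓝 (0 * Real.log 0)) :=
    (Real.continuous_mul_log.tendsto 0).comp hu
  have := h1.sub (h2.sub h3)
  simp only [zero_mul, sub_zero] at this
  refine this.congr fun i => ?_
  simp only [truncLogPrim]
  ring

end Scalar

/-! ### Pairings of square-integrable fields. -/

lemma norm_mul_norm_le_sq_add_sq {E : Type*} [NormedAddCommGroup E] (x y : E) :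
    ‖x‖ * ‖y‖ ≤ ‖x‖ ^ 2 + ‖y‖ ^ 2 := by
  nlinarith [sq_nonneg (‖x‖ - ‖y‖), sq_nonneg ‖x‖, sq_nonneg ‖y‖]

lemma integrable_inner_of_memLp_two {α E : Type*} [MeasurableSpace α]
    {μ : Measure α} [NormedAddCommGroup E] [InnerProductSpace ℝ E] {a c : α → E}
    (ha : MemLp a 2 μ) (hc : MemLp c 2 μ) : Integrable (fun x => inner ℝ (a x) (c x)) μ :=
  ((ha.integrable_norm_pow (by norm_num : (2:ℕ) ≠ 0)).add
    (hc.integrable_norm_pow (by norm_num : (2:ℕ) ≠ 0))).mono' (ha.1.inner hc.1)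
    (Eventually.of_forall fun x => (norm_inner_le_norm _ _).trans
      (norm_mul_norm_le_sq_add_sq _ _))

/-- A Riesz-type criterion: convergence of the norms and pointwise convergence where the limit
does not vanish give convergence of the pairings. -/
lemma tendsto_integral_inner_of_tendsto_integral_norm_sq {α E : Type*} [MeasurableSpace α]
    {μ : Measure α} [NormedAddCommGroup E] [InnerProductSpace ℝ E]
    {a c : α → E} {as cs : ℕ → α → E}
    (ha : MemLp a 2 μ) (hc : MemLp c 2 μ) (has : ∀ n, MemLp (as n) 2 μ)
    (hcs : ∀ n, MemLp (cs n) 2 μ)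
    (hlim : ∀ᵐ x ∂μ, (a x = 0 ∧ c x = 0) ∨
      (Tendsto (fun n => as n x) atTop (𝓝 (a x)) ∧ Tendsto (fun n => cs n x) atTop (𝓝 (c x))))
    (ha_norm : Tendsto (fun n => ∫ x, ‖as n x‖ ^ 2 ∂μ) atTop (𝓝 (∫ x, ‖a x‖ ^ 2 ∂μ)))
    (hc_norm : Tendsto (fun n => ∫ x, ‖cs n x‖ ^ 2 ∂μ) atTop (𝓝 (∫ x, ‖c x‖ ^ 2 ∂μ))) :
    Tendsto (fun n => ∫ x, inner ℝ (as n x) (cs n x) ∂μ) atTop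
      (𝓝 (∫ x, inner ℝ (a x) (c x) ∂μ)) := by
  -- Fatou's lemma for `‖a + c‖²` bounds the liminf of its integral from below. As the two pure
  -- squares converge, the cross term is lower semicontinuous. Replacing `c` by `-c` later gives the
  -- matching upper bound.
  have lower : ∀ {c : α → E} {cs : ℕ → α → E}, MemLp c 2 μ → (∀ n, MemLp (cs n) 2 μ) →
      (∀ᵐ x ∂μ, (a x = 0 ∧ c x = 0) ∨ (Tendsto (fun n => as n x) atTop (𝓝 (a x)) ∧
        Tendsto (fun n => cs n x) atTop (𝓝 (c x)))) →
      Tendsto (fun n => ∫ x, ‖cs n x‖ ^ 2 ∂μ) atTop (𝓝 (∫ x, ‖c x‖ ^ 2 ∂μ)) →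
      ∀ ε > 0, ∀ᶠ n in atTop, ∫ x, inner ℝ (a x) (c x) ∂μ - ε <
        ∫ x, inner ℝ (as n x) (cs n x) ∂μ := by
    intro c cs hc hcs hlim hc_norm ε hε
    have expand : ∀ {a c : α → E}, MemLp a 2 μ → MemLp c 2 μ →
        ∫ x, ‖a x + c x‖ ^ 2 ∂μ = ∫ x, ‖a x‖ ^ 2 ∂μ + 2 * ∫ x, inner ℝ (a x) (c x) ∂μ
          + ∫ x, ‖c x‖ ^ 2 ∂μ := by
      intro a c ha hc
      have hac : Integrable (fun x => inner ℝ (a x) (c x)) μ := integrable_inner_of_memLp_two ha hc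
      have h1 := ha.integrable_norm_pow (by norm_num : (2:ℕ) ≠ 0)
      have h2 := hc.integrable_norm_pow (by norm_num : (2:ℕ) ≠ 0)
      simp_rw [norm_add_sq_real]
      rw [integral_add (by exact h1.add (hac.const_mul 2)) h2, integral_add h1 (hac.const_mul 2),
        integral_const_mul]
    have hint : ∀ {a c : α → E}, MemLp a 2 μ → MemLp c 2 μ →
        Integrable (fun x => ‖a x + c x‖ ^ 2) μ := fun {a c} ha hc =>
      (ha.add hc).integrable_norm_pow (by norm_num : (2:ℕ) ≠ 0)
    have fatou : ENNReal.ofReal (∫ x, ‖a x + c x‖ ^ 2 ∂μ) ≤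
        liminf (fun n => ENNReal.ofReal (∫ x, ‖as n x + cs n x‖ ^ 2 ∂μ)) atTop := by
      have e : ∀ n, ENNReal.ofReal (∫ x, ‖as n x + cs n x‖ ^ 2 ∂μ) =
          ∫⁻ x, ENNReal.ofReal (‖as n x + cs n x‖ ^ 2) ∂μ := fun n =>
        ofReal_integral_eq_lintegral_ofReal (hint (has n) (hcs n))
          (Eventually.of_forall fun x => by positivity)
      simp_rw [e]
      rw [ofReal_integral_eq_lintegral_ofReal (hint ha hc)
          (Eventually.of_forall fun x => by positivity)]
      refine le_trans (lintegral_mono_ae ?_) (lintegral_liminf_le' fun n =>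
        (hint (has n) (hcs n)).aemeasurable.ennreal_ofReal)
      filter_upwards [hlim] with x hx
      rcases hx with ⟨h1, h2⟩ | ⟨h1, h2⟩
      · simp [h1, h2]
      · exact (ENNReal.tendsto_ofReal ((h1.add h2).norm.pow 2)).liminf_eq.ge
    have hsum : ∀ᶠ n in atTop, ∫ x, ‖a x + c x‖ ^ 2 ∂μ - ε < ∫ x, ‖as n x + cs n x‖ ^ 2 ∂μ := by
      -- `ENNReal.ofReal` flattens negative numbers, so the strict inequality passes through it only
      -- when the integral is positive.
      have h0 : 0 ≤ ∫ x, ‖a x + c x‖ ^ 2 ∂μ := integral_nonneg fun x => by positivity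
      rcases h0.eq_or_lt with h | h
      · rw [← h]
        refine Eventually.of_forall fun n => ?_
        have : 0 ≤ ∫ x, ‖as n x + cs n x‖ ^ 2 ∂μ := integral_nonneg fun x => by positivity
        linarith
      · have h3 : ENNReal.ofReal (∫ x, ‖a x + c x‖ ^ 2 ∂μ - ε) <
            ENNReal.ofReal (∫ x, ‖a x + c x‖ ^ 2 ∂μ) :=
          (ENNReal.ofReal_lt_ofReal_iff h).2 (by linarith)
        filter_upwards [eventually_lt_of_lt_liminf (h3.trans_le fatou)] with n hn
        exact lt_of_not_ge fun hle => absurd hn (not_lt.2 (ENNReal.ofReal_le_ofReal hle))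
    filter_upwards [hsum, ha_norm.eventually (gt_mem_nhds
        (show ∫ x, ‖a x‖ ^ 2 ∂μ < ∫ x, ‖a x‖ ^ 2 ∂μ + ε / 2 by linarith)),
      hc_norm.eventually (gt_mem_nhds
        (show ∫ x, ‖c x‖ ^ 2 ∂μ < ∫ x, ‖c x‖ ^ 2 ∂μ + ε / 2 by linarith))] with n h1 h2 h3
    rw [expand ha hc, expand (has n) (hcs n)] at h1
    linarith
  rw [Metric.tendsto_atTop']
  intro ε hε
  have hneg := lower (c := fun x => -c x) (cs := fun n x => -cs n x) hc.neg (fun n => (hcs n).neg)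
    (hlim.mono fun x hx => hx.imp (fun h => ⟨h.1, by simp [h.2]⟩) fun h => ⟨h.1, h.2.neg⟩)
    (by simpa using hc_norm) ε hε
  obtain ⟨N, hN⟩ := eventually_atTop.1 ((lower hc hcs hlim hc_norm ε hε).and hneg)
  refine ⟨N, fun n hn => ?_⟩
  obtain ⟨h1, h2⟩ := hN n hn.le
  simp only [inner_neg_right, integral_neg] at h2
  rw [Real.dist_eq, abs_lt]
  constructor <;> linarith

/-! ### Integration against a density, and cutoffs. -/

section DensMeasure

variable {d : ℕ} {p : EuclideanSpace ℝ (Fin d) → ℝ}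

lemma integral_densMeasure (hp : Measurable p) (hp0 : ∀ x, 0 ≤ p x)
    (g : EuclideanSpace ℝ (Fin d) → ℝ) :
    ∫ x, g x ∂(densMeasure p) = ∫ x, p x * g x := by
  rw [densMeasure, integral_withDensity_eq_integral_toReal_smul hp.ennreal_ofReal
    (Eventually.of_forall fun x => ENNReal.ofReal_lt_top)]
  simp [ENNReal.toReal_ofReal (hp0 _)]

lemma integrable_densMeasure_iff (hp : Measurable p) (hp0 : ∀ x, 0 ≤ p x)
    {g : EuclideanSpace ℝ (Fin d) → ℝ} :
    Integrable g (densMeasure p) ↔ Integrable (fun x => p x * g x) := by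
  rw [densMeasure, integrable_withDensity_iff_integrable_smul' hp.ennreal_ofReal
    (Eventually.of_forall fun x => ENNReal.ofReal_lt_top)]
  simp [ENNReal.toReal_ofReal (hp0 _)]

lemma ae_densMeasure_iff (hp : Measurable p) {q : EuclideanSpace ℝ (Fin d) → Prop} :
    (∀ᵐ x ∂(densMeasure p), q x) ↔ ∀ᵐ x, 0 < p x → q x := by
  rw [densMeasure, ae_withDensity_iff hp.ennreal_ofReal]
  simp [ENNReal.ofReal_eq_zero]

lemma ae_densMeasure_pos (hp : Measurable p) : ∀ᵐ x ∂(densMeasure p), 0 < p x :=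
  (ae_densMeasure_iff hp).2 (Eventually.of_forall fun _ h => h)

end DensMeasure

/-- Smooth cutoffs that exhaust the space, with gradients decaying quadratically. -/
lemma exists_cutoff (E : Type*) [NormedAddCommGroup E] [InnerProductSpace ℝ E]
    [FiniteDimensional ℝ E] :
    ∃ (χ : ℕ → E → ℝ) (C : ℝ), (∀ n, ContDiff ℝ 1 (χ n)) ∧ (∀ n, HasCompactSupport (χ n)) ∧
      (∀ n x, 0 ≤ χ n x) ∧ (∀ n x, χ n x ≤ 1) ∧
      (∀ x, Tendsto (fun n => χ n x) atTop (𝓝 1)) ∧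
      (∀ n x, ‖fderiv ℝ (χ n) x‖ ≤ C / ((n : ℝ) + 2) ^ 2) := by
  let φ : ContDiffBump (0 : E) := ⟨1, 2, by norm_num, by norm_num⟩
  have hφ : ContDiff ℝ 1 φ := φ.contDiff
  have hφ' : HasCompactSupport (fderiv ℝ φ) := φ.hasCompactSupport.fderiv ℝ
  obtain ⟨C, hC⟩ := hφ'.exists_bound_of_continuous (hφ.continuous_fderiv one_ne_zero)
  have hR : ∀ n : ℕ, (0:ℝ) < ((n : ℝ) + 2) ^ 2 := fun n => by positivity
  -- One bump dilated by `(n + 2) ^ 2`: the quadratic gradient decay has to beat `log(1/δ)` for `δ =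
  -- 1 / (n + 2)`.
  refine ⟨fun n x => φ ((((n : ℝ) + 2) ^ 2)⁻¹ • x), C, fun n => ?_, fun n => ?_,
    fun n x => φ.nonneg, fun n x => φ.le_one, fun x => ?_, fun n x => ?_⟩
  · exact hφ.comp (contDiff_const_smul _)
  · exact φ.hasCompactSupport.comp_smul (inv_ne_zero (hR n).ne')
  · refine tendsto_const_nhds.congr' ?_
    have : Tendsto (fun n : ℕ => ((n : ℝ) + 2) ^ 2) atTop atTop :=
      (tendsto_pow_atTop two_ne_zero).comp
        (tendsto_atTop_add_const_right _ _ tendsto_natCast_atTop_atTop)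
    filter_upwards [this.eventually_ge_atTop ‖x‖] with n hn
    refine (φ.one_of_mem_closedBall ?_).symm
    rw [mem_closedBall_zero_iff, norm_smul, norm_inv, Real.norm_of_nonneg (hR n).le,
      inv_mul_le_iff₀ (hR n)]
    simpa [show φ.rIn = 1 from rfl] using hn
  · rw [fderiv_comp_smul, norm_smul, norm_inv, Real.norm_of_nonneg (hR n).le, inv_mul_eq_div]
    gcongr
    exact hC _

/-! ### Calculus on the slab `[0, T] × E`. -/

section Regularity

variable {E : Type*} [NormedAddCommGroup E] [InnerProductSpace ℝ E]
  {T : ℝ} {h : ℝ → E → ℝ}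

/-- The partial derivative in time of `h` on `[0, T]`. -/
noncomputable def timeDeriv (T : ℝ) (h : ℝ → E → ℝ) (t : ℝ) (x : E) : ℝ :=
  fderivWithin ℝ (Function.uncurry h) (Set.Icc 0 T ×ˢ Set.univ) (t, x) (1, 0)

lemma uniqueDiffOn_slab (hT : 0 < T) :
    UniqueDiffOn ℝ (Set.Icc 0 T ×ˢ (Set.univ : Set E)) :=
  (uniqueDiffOn_Icc hT).prod uniqueDiffOn_univ

/-- The line `y ↦ (t, y)` never leaves the slab, so the spatial derivative is a full one even at the
endpoint times. -/
lemma hasFDerivAt_slice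
    (hh : ContDiffOn ℝ 1 (Function.uncurry h) (Set.Icc 0 T ×ˢ Set.univ))
    {t : ℝ} (ht : t ∈ Set.Icc 0 T) (x : E) :
    HasFDerivAt (h t) ((fderivWithin ℝ (Function.uncurry h) (Set.Icc 0 T ×ˢ Set.univ) (t, x)).comp
      (ContinuousLinearMap.inr ℝ ℝ E)) x := by
  have h1 := (hh.differentiableOn one_ne_zero (t, x) ⟨ht, trivial⟩).hasFDerivWithinAt
  have h2 : HasFDerivWithinAt (fun y : E => (t, y)) (ContinuousLinearMap.inr ℝ ℝ E) Set.univ x :=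
    (hasFDerivAt_prodMk_right t x).hasFDerivWithinAt
  exact hasFDerivWithinAt_univ.1 (h1.comp x h2 fun y _ => ⟨ht, trivial⟩)

lemma continuousOn_timeDeriv (hT : 0 < T)
    (hh : ContDiffOn ℝ 1 (Function.uncurry h) (Set.Icc 0 T ×ˢ Set.univ)) :
    ContinuousOn (Function.uncurry (timeDeriv T h)) (Set.Icc 0 T ×ˢ Set.univ) :=
  (hh.continuousOn_fderivWithin (uniqueDiffOn_slab hT) le_rfl).clm_apply continuousOn_const

variable [CompleteSpace E]

lemma continuousOn_gradient_slice (hT : 0 < T)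
    (hh : ContDiffOn ℝ 1 (Function.uncurry h) (Set.Icc 0 T ×ˢ Set.univ)) :
    ContinuousOn (fun q : ℝ × E => gradient (h q.1) q.2) (Set.Icc 0 T ×ˢ Set.univ) := by
  have h1 := hh.continuousOn_fderivWithin (uniqueDiffOn_slab hT) le_rfl
  refine ((InnerProductSpace.toDual ℝ E).symm.continuous.comp_continuousOn
    (h1.clm_comp (continuousOn_const (c := ContinuousLinearMap.inr ℝ ℝ E)))).congr fun q hq => ?_
  rw [gradient, (hasFDerivAt_slice hh hq.1 q.2).fderiv]
  rfl

lemma hasDerivWithinAt_along_curve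
    (hh : ContDiffOn ℝ 1 (Function.uncurry h) (Set.Icc 0 T ×ˢ Set.univ))
    {t : ℝ} (ht : t ∈ Set.Icc 0 T) {Y : ℝ → E} {Y' : E}
    (hY : HasDerivWithinAt Y Y' (Set.Icc 0 T) t) :
    HasDerivWithinAt (fun τ => h τ (Y τ))
      (timeDeriv T h t (Y t) + inner ℝ (gradient (h t) (Y t)) Y') (Set.Icc 0 T) t := by
  have h1 := (hh.differentiableOn one_ne_zero (t, Y t) ⟨ht, trivial⟩).hasFDerivWithinAt
  have h2 : HasDerivWithinAt (fun τ => (τ, Y τ)) (1, Y') (Set.Icc 0 T) t :=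
    (hasDerivWithinAt_id t _).prodMk hY
  have hmaps : Set.MapsTo (fun τ => (τ, Y τ)) (Set.Icc 0 T) (Set.Icc 0 T ×ˢ Set.univ) :=
    fun τ hτ => ⟨hτ, trivial⟩
  refine (h1.comp_hasDerivWithinAt t h2 hmaps).congr_deriv ?_
  have h3 : ((1 : ℝ), Y') = (1, 0) + ContinuousLinearMap.inr ℝ ℝ E Y' := by simp
  rw [h3, map_add, gradient, InnerProductSpace.toDual_symm_apply,
    (hasFDerivAt_slice hh ht (Y t)).fderiv]
  rfl

/-- A zero of a nonnegative function is a minimum. This makes the convention `0⁻¹ = 0` harmless in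
`h⁻¹ • ∇h` at zeros of the density. -/
lemma gradient_eq_zero_of_nonneg {φ : E → ℝ} (hφ : ∀ y, 0 ≤ φ y) {x : E} (hx : φ x = 0) :
    gradient φ x = 0 := by
  have : IsLocalMin φ x := Eventually.of_forall fun y => by rw [hx]; exact hφ y
  rw [gradient, this.fderiv_eq_zero, map_zero]

lemma gradient_log {φ : E → ℝ} {x : E} (hφ : DifferentiableAt ℝ φ x) (hx : φ x ≠ 0) :
    gradient (fun y => Real.log (φ y)) x = (φ x)⁻¹ • gradient φ x := by
  rw [gradient, fderiv.log hφ hx, map_smulₛₗ]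
  rfl

end Regularity

/-! ### Density flows and the truncated entropy identity. -/

/-- A process `X` with velocity `b`, whose law at time `r` has density `h r` relative to `π dx`.
Here `k` and `g` are the time derivative and the spatial gradient of `h`. The differential
relations hold on `[0, T]`; outside this interval everything is extended measurably. -/
structure IsDensityFlow {d : ℕ} {Ω : Type*} [MeasurableSpace Ω] (T : ℝ)
    (π : EuclideanSpace ℝ (Fin d) → ℝ) (h k : ℝ → EuclideanSpace ℝ (Fin d) → ℝ)
    (g b : ℝ → EuclideanSpace ℝ (Fin d) → EuclideanSpace ℝ (Fin d))
    (P : Measure Ω) (X : ℝ → Ω → EuclideanSpace ℝ (Fin d)) : Prop where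
  pos : ∀ x, 0 < π x
  cont : Continuous π
  integrable : Integrable π
  h_nonneg : ∀ r x, 0 ≤ h r x
  h_cont : Continuous (Function.uncurry h)
  k_cont : Continuous (Function.uncurry k)
  g_cont : Continuous (Function.uncurry g)
  g_eq_zero : ∀ r x, h r x = 0 → g r x = 0
  b_meas : Measurable (Function.uncurry b)
  X_meas : Measurable (Function.uncurry X)
  chain : ∀ t ∈ Set.Icc 0 T, ∀ (Y : ℝ → EuclideanSpace ℝ (Fin d)) (Y' : EuclideanSpace ℝ (Fin d)),
    HasDerivWithinAt Y Y' (Set.Icc 0 T) t →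
    HasDerivWithinAt (fun τ => h τ (Y τ)) (k t (Y t) + inner ℝ (g t (Y t)) Y') (Set.Icc 0 T) t
  ode : ∀ᵐ ω ∂P, ∀ t ∈ Set.Icc 0 T,
    HasDerivWithinAt (fun τ => X τ ω) (b t (X t ω)) (Set.Icc 0 T) t
  law : ∀ r, P.map (X r) = densMeasure (fun x => π x * h r x)
  density : ∀ r, Integrable (fun x => π x * h r x)
  mass : ∀ r, ∫ x, π x * h r x = 1
  score_sq : ∀ t, Integrable (fun z : ℝ × Ω => ‖(h z.1 (X z.1 z.2))⁻¹ • g z.1 (X z.1 z.2)‖ ^ 2)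
    ((volume.restrict (Set.Ioc 0 t)).prod P)
  velocity_sq : ∀ t, Integrable (fun z : ℝ × Ω => ‖b z.1 (X z.1 z.2)‖ ^ 2)
    ((volume.restrict (Set.Ioc 0 t)).prod P)

namespace IsDensityFlow

variable {d : ℕ} {Ω : Type*} [MeasurableSpace Ω] {T : ℝ}
    {π : EuclideanSpace ℝ (Fin d) → ℝ} {h k : ℝ → EuclideanSpace ℝ (Fin d) → ℝ}
    {g b : ℝ → EuclideanSpace ℝ (Fin d) → EuclideanSpace ℝ (Fin d)}
    {P : Measure Ω} {X : ℝ → Ω → EuclideanSpace ℝ (Fin d)}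
    {δ t : ℝ} {χ : EuclideanSpace ℝ (Fin d) → ℝ}

lemma h_cont_slice (F : IsDensityFlow T π h k g b P X) (r : ℝ) : Continuous (h r) :=
  F.h_cont.comp (Continuous.prodMk_right r)

lemma density_meas (F : IsDensityFlow T π h k g b P X) (r : ℝ) :
    Measurable (fun x => π x * h r x) :=
  (F.cont.mul (F.h_cont_slice r)).measurable

lemma density_nonneg (F : IsDensityFlow T π h k g b P X) (r : ℝ)
    (x : EuclideanSpace ℝ (Fin d)) : 0 ≤ π x * h r x :=
  mul_nonneg (F.pos x).le (F.h_nonneg r x)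

lemma X_meas_slice (F : IsDensityFlow T π h k g b P X) (r : ℝ) : Measurable (X r) :=
  F.X_meas.comp measurable_prodMk_left

lemma integral_comp (F : IsDensityFlow T π h k g b P X) (r : ℝ)
    {φ : EuclideanSpace ℝ (Fin d) → ℝ} (hφ : Measurable φ) :
    ∫ ω, φ (X r ω) ∂P = ∫ x, φ x ∂(densMeasure (fun x => π x * h r x)) := by
  rw [← F.law r, integral_map (F.X_meas_slice r).aemeasurable hφ.aestronglyMeasurable]

lemma joint_meas (F : IsDensityFlow T π h k g b P X) :
    Measurable (fun z : ℝ × Ω => (z.1, X z.1 z.2)) :=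
  measurable_fst.prodMk F.X_meas

lemma truncLogDeriv_cont (F : IsDensityFlow T π h k g b P X) (hδ : 0 < δ) :
    Continuous (fun q : ℝ × EuclideanSpace ℝ (Fin d) => truncLogDeriv δ (h q.1 q.2)) := by
  have hc : Continuous (fun q : ℝ × EuclideanSpace ℝ (Fin d) => h q.1 q.2) := F.h_cont
  have h0 := fun q : ℝ × EuclideanSpace ℝ (Fin d) => F.h_nonneg q.1 q.2
  unfold truncLogDeriv
  refine (continuous_const.div (hc.add continuous_const) fun q => ?_).sub
    (continuous_const.div (continuous_const.add (continuous_const.mul hc)) fun q => ?_)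
  · exact (add_pos_of_nonneg_of_pos (h0 q) hδ).ne'
  · exact (add_pos_of_pos_of_nonneg one_pos (mul_nonneg hδ.le (h0 q))).ne'

lemma truncLog_cont (F : IsDensityFlow T π h k g b P X) (hδ : 0 < δ) :
    Continuous (fun q : ℝ × EuclideanSpace ℝ (Fin d) => truncLog δ (h q.1 q.2)) := by
  have hc : Continuous (fun q : ℝ × EuclideanSpace ℝ (Fin d) => h q.1 q.2) := F.h_cont
  have h0 := fun q : ℝ × EuclideanSpace ℝ (Fin d) => F.h_nonneg q.1 q.2
  unfold truncLog
  refine ((hc.add continuous_const).log fun q => ?_).sub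
    ((continuous_const.add (continuous_const.mul hc)).log fun q => ?_)
  · exact (add_pos_of_nonneg_of_pos (h0 q) hδ).ne'
  · exact (add_pos_of_pos_of_nonneg one_pos (mul_nonneg hδ.le (h0 q))).ne'

/-- The contribution of the time derivative of `h`. -/
noncomputable def timeTerm (δ : ℝ) (χ : EuclideanSpace ℝ (Fin d) → ℝ)
    (h k : ℝ → EuclideanSpace ℝ (Fin d) → ℝ) (r : ℝ) (x : EuclideanSpace ℝ (Fin d)) : ℝ :=
  χ x * truncLogDeriv δ (h r x) * k r x

/-- The contribution of the gradient of the cutoff. -/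
noncomputable def cutoffTerm (δ : ℝ) (χ : EuclideanSpace ℝ (Fin d) → ℝ)
    (h : ℝ → EuclideanSpace ℝ (Fin d) → ℝ)
    (b : ℝ → EuclideanSpace ℝ (Fin d) → EuclideanSpace ℝ (Fin d))
    (r : ℝ) (x : EuclideanSpace ℝ (Fin d)) : ℝ :=
  truncLog δ (h r x) * fderiv ℝ χ x (b r x)

/-- The contribution of the spatial gradient of `h`. -/
noncomputable def scoreTerm (δ : ℝ) (χ : EuclideanSpace ℝ (Fin d) → ℝ)
    (h : ℝ → EuclideanSpace ℝ (Fin d) → ℝ)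
    (g b : ℝ → EuclideanSpace ℝ (Fin d) → EuclideanSpace ℝ (Fin d))
    (r : ℝ) (x : EuclideanSpace ℝ (Fin d)) : ℝ :=
  χ x * (h r x * truncLogDeriv δ (h r x)) * inner ℝ ((h r x)⁻¹ • g r x) (b r x)

lemma hasDerivWithinAt_test (F : IsDensityFlow T π h k g b P X) (hδ : 0 < δ)
    (hχ : ContDiff ℝ 1 χ) {Y : ℝ → EuclideanSpace ℝ (Fin d)} (ht : t ∈ Set.Icc 0 T)
    (hY : HasDerivWithinAt Y (b t (Y t)) (Set.Icc 0 T) t) :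
    HasDerivWithinAt (fun τ => χ (Y τ) * truncLog δ (h τ (Y τ)))
      (timeTerm δ χ h k t (Y t) + cutoffTerm δ χ h b t (Y t) + scoreTerm δ χ h g b t (Y t))
      (Set.Icc 0 T) t := by
  have h1 := ((hχ.differentiable one_ne_zero (Y t)).hasFDerivAt).comp_hasDerivWithinAt t hY
  have h2 := (hasDerivAt_truncLog hδ (F.h_nonneg t (Y t))).comp_hasDerivWithinAt t
    (F.chain t ht Y _ hY)
  refine (h1.mul h2).congr_deriv ?_
  simp only [timeTerm, cutoffTerm, scoreTerm, Function.comp]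
  rw [real_inner_smul_left]
  -- At a zero of `h` the score term is `0` because `0⁻¹ = 0`; the true derivative agrees since the
  -- gradient vanishes there.
  by_cases h0 : h t (Y t) = 0
  · rw [F.g_eq_zero t _ h0, h0]
    simp
    ring
  · field_simp
    ring

lemma timeTerm_cont (F : IsDensityFlow T π h k g b P X) (hδ : 0 < δ) (hχ : ContDiff ℝ 1 χ) :
    Continuous (Function.uncurry (timeTerm δ χ h k)) :=
  ((hχ.continuous.comp continuous_snd).mul (F.truncLogDeriv_cont hδ)).mul F.k_cont

lemma exists_bound_of_cutoff {w : ℝ → EuclideanSpace ℝ (Fin d) → ℝ}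
    (hw : Continuous (Function.uncurry w)) (hχ : HasCompactSupport χ)
    (hχw : ∀ r x, χ x = 0 → w r x = 0) (t : ℝ) :
    ∃ C, ∀ r ∈ Set.Ioc 0 t, ∀ x, |w r x| ≤ C := by
  obtain ⟨C, hC⟩ := (isCompact_Icc (a := (0:ℝ)) (b := t)).prod hχ
    |>.exists_bound_of_continuousOn hw.continuousOn
  refine ⟨max C 0, fun r hr x => ?_⟩
  by_cases hx : x ∈ tsupport χ
  · exact (hC (r, x) ⟨Set.Ioc_subset_Icc_self hr, hx⟩).trans (le_max_left _ _)
  · rw [hχw r x (image_eq_zero_of_notMem_tsupport hx), abs_zero]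
    exact le_max_right _ _

lemma cutoffTerm_meas (F : IsDensityFlow T π h k g b P X) (hδ : 0 < δ) (hχ : ContDiff ℝ 1 χ) :
    Measurable (Function.uncurry (cutoffTerm δ χ h b)) := by
  refine (F.truncLog_cont hδ).measurable.mul ?_
  have : Continuous fun q : EuclideanSpace ℝ (Fin d) × EuclideanSpace ℝ (Fin d) =>
      fderiv ℝ χ q.1 q.2 :=
    ((hχ.continuous_fderiv one_ne_zero).comp continuous_fst).clm_apply continuous_snd
  exact this.measurable.comp (measurable_snd.prodMk F.b_meas)

/-- The truncation costs a factor `log(1/δ)`, to be compensated by the smallness of the cutoff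
gradient `C`. -/
lemma abs_cutoffTerm_le (F : IsDensityFlow T π h k g b P X) (hδ : 0 < δ) (hδ1 : δ < 1) {C : ℝ}
    (hC : ∀ x, ‖fderiv ℝ χ x‖ ≤ C) (r : ℝ) (x : EuclideanSpace ℝ (Fin d)) :
    |cutoffTerm δ χ h b r x| ≤ -Real.log δ * C * (1 + ‖b r x‖ ^ 2) := by
  have h1 := abs_truncLog_le_neg_log hδ hδ1 (F.h_nonneg r x)
  have h2 : |fderiv ℝ χ x (b r x)| ≤ C * (1 + ‖b r x‖ ^ 2) := by
    refine ((fderiv ℝ χ x).le_of_opNorm_le (hC x) _).trans ?_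
    have : 0 ≤ C := (norm_nonneg _).trans (hC x)
    gcongr
    nlinarith [sq_nonneg (‖b r x‖ - 1)]
  rw [cutoffTerm, abs_mul, mul_assoc]
  exact mul_le_mul h1 h2 (abs_nonneg _) ((abs_nonneg _).trans h1)

lemma pairing_meas (F : IsDensityFlow T π h k g b P X) :
    Measurable (fun q : ℝ × EuclideanSpace ℝ (Fin d) =>
      inner ℝ ((h q.1 q.2)⁻¹ • g q.1 q.2) (b q.1 q.2)) :=
  (F.h_cont.measurable.inv.smul F.g_cont.measurable).inner F.b_meas

lemma scoreTerm_meas (F : IsDensityFlow T π h k g b P X) (hδ : 0 < δ) (hχ : ContDiff ℝ 1 χ) :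
    Measurable (Function.uncurry (scoreTerm δ χ h g b)) :=
  ((hχ.continuous.comp continuous_snd).mul
    (F.h_cont.mul (F.truncLogDeriv_cont hδ))).measurable.mul F.pairing_meas

lemma abs_scoreTerm_le (F : IsDensityFlow T π h k g b P X) (hδ : 0 < δ)
    (hχ0 : ∀ x, 0 ≤ χ x) (hχ1 : ∀ x, χ x ≤ 1) (r : ℝ) (x : EuclideanSpace ℝ (Fin d)) :
    |scoreTerm δ χ h g b r x| ≤ ‖(h r x)⁻¹ • g r x‖ ^ 2 + ‖b r x‖ ^ 2 := by
  have h1 : |χ x * (h r x * truncLogDeriv δ (h r x))| ≤ 1 := by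
    rw [abs_mul, abs_of_nonneg (hχ0 x)]
    exact mul_le_one₀ (hχ1 x) (abs_nonneg _) (abs_mul_truncLogDeriv_le hδ (F.h_nonneg r x))
  rw [scoreTerm, abs_mul]
  calc _ ≤ 1 * (‖(h r x)⁻¹ • g r x‖ * ‖b r x‖) := by
        gcongr
        exact abs_real_inner_le_norm _ _
    _ ≤ _ := by rw [one_mul]; exact norm_mul_norm_le_sq_add_sq _ _

lemma integrable_scoreTerm (F : IsDensityFlow T π h k g b P X) (hδ : 0 < δ) (hχ : ContDiff ℝ 1 χ)
    (hχ0 : ∀ x, 0 ≤ χ x) (hχ1 : ∀ x, χ x ≤ 1) (t : ℝ) :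
    Integrable (fun z : ℝ × Ω => scoreTerm δ χ h g b z.1 (X z.1 z.2))
      ((volume.restrict (Set.Ioc 0 t)).prod P) :=
  ((F.score_sq t).add (F.velocity_sq t)).mono'
    ((F.scoreTerm_meas hδ hχ).comp F.joint_meas).aestronglyMeasurable
    (Eventually.of_forall fun _ => F.abs_scoreTerm_le hδ hχ0 hχ1 _ _)

variable [IsProbabilityMeasure P]

lemma integrable_timeTerm (F : IsDensityFlow T π h k g b P X) (hδ : 0 < δ) (hχ : ContDiff ℝ 1 χ)
    (hχc : HasCompactSupport χ) (t : ℝ) :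
    Integrable (fun z : ℝ × Ω => timeTerm δ χ h k z.1 (X z.1 z.2))
      ((volume.restrict (Set.Ioc 0 t)).prod P) := by
  obtain ⟨C, hC⟩ := exists_bound_of_cutoff (F.timeTerm_cont hδ hχ) hχc
    (fun r x hx => by simp [timeTerm, hx]) t
  refine Integrable.of_bound ((F.timeTerm_cont hδ hχ).measurable.comp
    F.joint_meas).aestronglyMeasurable C ?_
  have : ∀ᵐ r ∂(volume.restrict (Set.Ioc 0 t)), r ∈ Set.Ioc 0 t := ae_restrict_mem measurableSet_Ioc
  filter_upwards [Measure.quasiMeasurePreserving_fst.ae this] with z hz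
  exact hC z.1 hz _

/-- Taking the mean multiplies by the density `π h`, and `h * truncLogDeriv δ h * ∂_t h` is the time
derivative of `truncLogPrim δ h`. Fubini and the fundamental theorem of calculus at fixed `x` then
remove `∂_t h`. -/
lemma integral_timeTerm (F : IsDensityFlow T π h k g b P X) (hδ : 0 < δ) (hχ : ContDiff ℝ 1 χ)
    (hχc : HasCompactSupport χ) (ht : t ∈ Set.Icc 0 T) :
    ∫ z : ℝ × Ω, timeTerm δ χ h k z.1 (X z.1 z.2) ∂((volume.restrict (Set.Ioc 0 t)).prod P) =
      ∫ x, χ x * (π x * (truncLogPrim δ (h t x) - truncLogPrim δ (h 0 x))) := by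
  rw [integral_prod _ (F.integrable_timeTerm hδ hχ hχc t)]
  have hcont : Continuous (Function.uncurry fun (r : ℝ) (x : EuclideanSpace ℝ (Fin d)) =>
      π x * h r x * timeTerm δ χ h k r x) :=
    ((F.cont.comp continuous_snd).mul F.h_cont).mul (F.timeTerm_cont hδ hχ)
  have h1 : ∀ r, ∫ ω, timeTerm δ χ h k r (X r ω) ∂P =
      ∫ x, π x * h r x * timeTerm δ χ h k r x := fun r => by
    rw [F.integral_comp r (φ := timeTerm δ χ h k r)
      ((F.timeTerm_cont hδ hχ).comp (Continuous.prodMk_right r)).measurable,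
      integral_densMeasure (F.density_meas r) (F.density_nonneg r)]
  simp_rw [h1]
  obtain ⟨C, hC⟩ := exists_bound_of_cutoff hcont hχc
    (fun r x hx => by simp [timeTerm, hx]) t
  rw [integral_integral_swap]
  · refine integral_congr_ae (Eventually.of_forall fun x => ?_)
    show ∫ r in Set.Ioc 0 t, π x * h r x * timeTerm δ χ h k r x = _
    rw [← intervalIntegral.integral_of_le ht.1]
    have hderiv : ∀ r ∈ Set.Icc 0 t, HasDerivWithinAt
        (fun r => χ x * (π x * truncLogPrim δ (h r x)))
        (π x * h r x * timeTerm δ χ h k r x) (Set.Icc 0 t) r := by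
      intro r hr
      have hr' : r ∈ Set.Icc 0 T := ⟨hr.1, hr.2.trans ht.2⟩
      -- The chain rule along a constant curve identifies `k` as the time derivative of `h`.
      have hk := F.chain r hr' (fun _ => x) 0 (hasDerivWithinAt_const _ _ _)
      simp only [inner_zero_right, add_zero] at hk
      have := (hasDerivAt_truncLogPrim hδ (F.h_nonneg r x)).comp_hasDerivWithinAt r hk
      refine (((this.mono (Set.Icc_subset_Icc_right ht.2)).const_mul (π x)).const_mul
        (χ x)).congr_deriv ?_
      simp only [timeTerm]
      ring
    rw [intervalIntegral.integral_eq_sub_of_hasDerivAt_of_le ht.1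
      (fun r hr => (hderiv r hr).continuousWithinAt)
      (fun r hr => (hderiv r (Set.Ioo_subset_Icc_self hr)).hasDerivAt (Icc_mem_nhds hr.1 hr.2))
      ((hcont.comp (Continuous.prodMk_left x)).intervalIntegrable _ _)]
    ring
  · have hK : Integrable (Set.indicator (tsupport χ) fun _ => C) volume :=
      (integrable_indicator_iff hχc.measurableSet).2
        (integrableOn_const hχc.measure_lt_top.ne)
    refine ((integrable_const (1:ℝ)).mul_prod hK).mono' hcont.aestronglyMeasurable ?_
    have : ∀ᵐ r ∂(volume.restrict (Set.Ioc 0 t)), r ∈ Set.Ioc 0 t :=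
      ae_restrict_mem measurableSet_Ioc
    filter_upwards [Measure.quasiMeasurePreserving_fst.ae this] with z hz
    by_cases hx : z.2 ∈ tsupport χ
    · simpa [hx, Function.uncurry] using hC z.1 hz z.2
    · simp [Function.uncurry, timeTerm, hx, image_eq_zero_of_notMem_tsupport hx]

lemma integrable_one_add_velocity_sq (F : IsDensityFlow T π h k g b P X) (t : ℝ) :
    Integrable (fun z : ℝ × Ω => 1 + ‖b z.1 (X z.1 z.2)‖ ^ 2)
      ((volume.restrict (Set.Ioc 0 t)).prod P) :=
  (integrable_const 1).add (F.velocity_sq t)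

lemma integrable_cutoffTerm (F : IsDensityFlow T π h k g b P X) (hδ : 0 < δ) (hδ1 : δ < 1)
    (hχ : ContDiff ℝ 1 χ) {C : ℝ} (hC : ∀ x, ‖fderiv ℝ χ x‖ ≤ C) (t : ℝ) :
    Integrable (fun z : ℝ × Ω => cutoffTerm δ χ h b z.1 (X z.1 z.2))
      ((volume.restrict (Set.Ioc 0 t)).prod P) :=
  ((F.integrable_one_add_velocity_sq t).const_mul (-Real.log δ * C)).mono'
    ((F.cutoffTerm_meas hδ hχ).comp F.joint_meas).aestronglyMeasurable
    (Eventually.of_forall fun _ => F.abs_cutoffTerm_le hδ hδ1 hC _ _)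

/-- The weak form of the evolution of the truncated entropy. -/
lemma integral_test_sub (F : IsDensityFlow T π h k g b P X) (hδ : 0 < δ) (hδ1 : δ < 1)
    (hχ : ContDiff ℝ 1 χ) (hχc : HasCompactSupport χ) (hχ0 : ∀ x, 0 ≤ χ x) (hχ1 : ∀ x, χ x ≤ 1)
    {C : ℝ} (hC : ∀ x, ‖fderiv ℝ χ x‖ ≤ C) (ht : t ∈ Set.Icc 0 T) :
    ∫ x, χ x * truncLog δ (h t x) ∂(densMeasure fun x => π x * h t x) -
      ∫ x, χ x * truncLog δ (h 0 x) ∂(densMeasure fun x => π x * h 0 x) =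
    (∫ x, χ x * (π x * (truncLogPrim δ (h t x) - truncLogPrim δ (h 0 x)))) +
      ∫ z : ℝ × Ω, cutoffTerm δ χ h b z.1 (X z.1 z.2) ∂((volume.restrict (Set.Ioc 0 t)).prod P) +
      ∫ z : ℝ × Ω, scoreTerm δ χ h g b z.1 (X z.1 z.2)
        ∂((volume.restrict (Set.Ioc 0 t)).prod P) := by
  have i1 := F.integrable_timeTerm hδ hχ hχc t
  have i2 := F.integrable_cutoffTerm hδ hδ1 hχ hC t
  have i3 := F.integrable_scoreTerm hδ hχ hχ0 hχ1 t
  have i12 := i1.add i2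
  have i123 := i12.add i3
  have hcont : ∀ r, Continuous fun x => χ x * truncLog δ (h r x) := fun r =>
    hχ.continuous.mul ((F.truncLog_cont hδ).comp (Continuous.prodMk_right r))
  have hint : ∀ r, Integrable (fun ω => χ (X r ω) * truncLog δ (h r (X r ω))) P := by
    intro r
    refine Integrable.of_bound (C := -Real.log δ)
      ((hcont r).measurable.comp (F.X_meas_slice r)).aestronglyMeasurable
      (Eventually.of_forall fun ω => ?_)
    have h1 := abs_truncLog_le_neg_log hδ hδ1 (F.h_nonneg r (X r ω))
    rw [Real.norm_eq_abs, abs_mul, abs_of_nonneg (hχ0 _)]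
    exact (mul_le_of_le_one_left (abs_nonneg _) (hχ1 _)).trans h1
  rw [← F.integral_timeTerm hδ hχ hχc ht, ← integral_add i1 i2, ← integral_add (by exact i12) i3,
    ← F.integral_comp t (hcont t).measurable, ← F.integral_comp 0 (hcont 0).measurable,
    ← integral_sub (hint t) (hint 0), integral_prod_symm _ (by exact i123)]
  refine integral_congr_ae ?_
  -- The velocity is only measurable, so the derivative along a trajectory need not be continuous in
  -- time; its integrability for almost every `ω` comes from Fubini.
  filter_upwards [F.ode, i123.prod_left_ae] with ω hω hiω
  rw [← intervalIntegral.integral_of_le ht.1]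
  have hderiv : ∀ r ∈ Set.Icc 0 t, HasDerivWithinAt
      (fun τ => χ (X τ ω) * truncLog δ (h τ (X τ ω)))
      (timeTerm δ χ h k r (X r ω) + cutoffTerm δ χ h b r (X r ω) + scoreTerm δ χ h g b r (X r ω))
      (Set.Icc 0 t) r := fun r hr =>
    (F.hasDerivWithinAt_test hδ hχ ⟨hr.1, hr.2.trans ht.2⟩ (hω r ⟨hr.1, hr.2.trans ht.2⟩)).mono
      (Set.Icc_subset_Icc_right ht.2)
  refine (intervalIntegral.integral_eq_sub_of_hasDerivAt_of_le ht.1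
    (fun r hr => (hderiv r hr).continuousWithinAt)
    (fun r hr => (hderiv r (Set.Ioo_subset_Icc_self hr)).hasDerivAt (Icc_mem_nhds hr.1 hr.2))
    ((intervalIntegrable_iff_integrableOn_Ioc_of_le ht.1).2 hiω)).symm

end IsDensityFlow

/-! ### Removal of the truncation and the entropy balance. -/

/-- Integrability of an a.e. limit of functions with a common integrable minorant and bounded
integrals. -/
lemma integrable_of_tendsto_of_integral_le {α : Type*} [MeasurableSpace α] {m : Measure α}
    {ψ N : α → ℝ} {ψs : ℕ → α → ℝ} {K : ℝ} (hψs : ∀ n, Integrable (ψs n) m)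
    (hlim : ∀ᵐ x ∂m, Tendsto (fun n => ψs n x) atTop (𝓝 (ψ x))) (hN : Integrable N m)
    (hlow : ∀ n, ∀ᵐ x ∂m, -N x ≤ ψs n x) (hK : ∀ n, ∫ x, ψs n x ∂m ≤ K) : Integrable ψ m := by
  -- Adding `N` makes the functions nonnegative, so Fatou's lemma applies.
  have hsum : ∀ n, Integrable (fun x => ψs n x + N x) m := fun n => (hψs n).add hN
  have hlim' : ∀ᵐ x ∂m, Tendsto (fun n => ψs n x + N x) atTop (𝓝 (ψ x + N x)) :=
    hlim.mono fun x hx => hx.add_const _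
  have hbound : ∀ n, ∫⁻ x, ‖ψs n x + N x‖ₑ ∂m ≤ ENNReal.ofReal (K + ∫ x, N x ∂m) := by
    intro n
    have h0 : 0 ≤ᵐ[m] fun x => ψs n x + N x := (hlow n).mono fun x hx => by
      show 0 ≤ ψs n x + N x
      linarith
    calc ∫⁻ x, ‖ψs n x + N x‖ₑ ∂m = ∫⁻ x, ENNReal.ofReal (ψs n x + N x) ∂m :=
          lintegral_congr_ae (h0.mono fun x hx => Real.enorm_eq_ofReal hx)
      _ = ENNReal.ofReal (∫ x, (ψs n x + N x) ∂m) :=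
          (ofReal_integral_eq_lintegral_ofReal (hsum n) h0).symm
      _ ≤ _ := by
          rw [integral_add (hψs n) hN]
          exact ENNReal.ofReal_le_ofReal (by linarith [hK n])
  have hint : Integrable (fun x => ψ x + N x) m := by
    refine ⟨aestronglyMeasurable_of_tendsto_ae atTop (fun n => (hsum n).1) hlim', ?_⟩
    have hfatou : ∫⁻ x, ‖ψ x + N x‖ₑ ∂m ≤ liminf (fun n => ∫⁻ x, ‖ψs n x + N x‖ₑ ∂m) atTop :=
      (lintegral_mono_ae (hlim'.mono fun x hx => hx.enorm.liminf_eq.ge)).trans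
        (lintegral_liminf_le' fun n => (hsum n).1.aemeasurable.enorm)
    refine lt_of_le_of_lt hfatou (lt_of_le_of_lt ?_
      (ENNReal.ofReal_lt_top (r := K + ∫ x, N x ∂m)))
    exact liminf_le_of_le (by isBoundedDefault) fun a ha => by
      obtain ⟨n, hn⟩ := ha.exists
      exact hn.trans (hbound n)
  exact (hint.sub hN).congr (Eventually.of_forall fun x => add_sub_cancel_right _ _)

namespace IsDensityFlow

variable {d : ℕ} {Ω : Type*} [MeasurableSpace Ω] {T : ℝ}
    {π : EuclideanSpace ℝ (Fin d) → ℝ} {h k : ℝ → EuclideanSpace ℝ (Fin d) → ℝ}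
    {g b : ℝ → EuclideanSpace ℝ (Fin d) → EuclideanSpace ℝ (Fin d)}
    {P : Measure Ω} {X : ℝ → Ω → EuclideanSpace ℝ (Fin d)}
    {t : ℝ}

lemma ae_h_pos (F : IsDensityFlow T π h k g b P X) (r : ℝ) :
    ∀ᵐ x ∂(densMeasure fun x => π x * h r x), 0 < h r x :=
  (ae_densMeasure_pos (F.density_meas r)).mono fun x hx => pos_of_mul_pos_right hx (F.pos x).le

/-- `-y log y ≤ 1 - y ≤ 1` for `y > 0`, so after multiplication by `π h` the negative part is
dominated by the integrable `π`. -/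
lemma integrable_negPart_log (F : IsDensityFlow T π h k g b P X) (r : ℝ) :
    Integrable (fun x => max (-Real.log (h r x)) 0) (densMeasure fun x => π x * h r x) := by
  rw [integrable_densMeasure_iff (F.density_meas r) (F.density_nonneg r)]
  refine F.integrable.mono' ((F.density_meas r).mul
    ((Real.measurable_log.comp (F.h_cont_slice r).measurable).neg.max
      measurable_const)).aestronglyMeasurable (Eventually.of_forall fun x => ?_)
  have h0 := F.h_nonneg r x
  rw [Real.norm_of_nonneg (mul_nonneg (F.density_nonneg r x) (le_max_right _ _)), mul_assoc]
  refine mul_le_of_le_one_right (F.pos x).le ?_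
  rcases h0.eq_or_lt with h1 | h1
  · rw [← h1]; simp
  rcases le_total (-Real.log (h r x)) 0 with h2 | h2
  · rw [max_eq_right h2]; simp
  · rw [max_eq_left h2]
    have h3 := Real.one_sub_inv_le_log_of_pos h1
    calc h r x * -Real.log (h r x) ≤ h r x * ((h r x)⁻¹ - 1) := by
          gcongr
          linarith
      _ = 1 - h r x := by field_simp
      _ ≤ 1 := by linarith

variable [IsProbabilityMeasure P]

/-- The entropy balance along a density flow. -/
theorem entropy_balance (F : IsDensityFlow T π h k g b P X) (ht : t ∈ Set.Icc 0 T)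
    (h_init : Integrable (fun x => Real.log (h 0 x)) (densMeasure fun x => π x * h 0 x)) :
    Integrable (fun x => Real.log (h t x)) (densMeasure fun x => π x * h t x) ∧
    ∫ x, Real.log (h t x) ∂(densMeasure fun x => π x * h t x) =
      ∫ x, Real.log (h 0 x) ∂(densMeasure fun x => π x * h 0 x) +
      ∫ r in (0:ℝ)..t, ∫ x, inner ℝ ((h r x)⁻¹ • g r x) (b r x)
        ∂(densMeasure fun x => π x * h r x) := by
  obtain ⟨χ, C, hχ, hχc, hχ0, hχ1, hχlim, hC⟩ := exists_cutoff (EuclideanSpace ℝ (Fin d))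
  -- The truncation level is tied to the cutoff index; the shift by two keeps `δ < 1` at `n = 0`.
  set δ : ℕ → ℝ := fun n => ((n : ℝ) + 2)⁻¹ with hδdef
  have hδ : ∀ n, 0 < δ n := fun n => by positivity
  have hδ1 : ∀ n, δ n < 1 := fun n => inv_lt_one_of_one_lt₀ (by linarith [n.cast_nonneg (α := ℝ)])
  have hδlim : Tendsto δ atTop (𝓝 0) := tendsto_inv_atTop_zero.comp
    (tendsto_atTop_add_const_right _ _ tendsto_natCast_atTop_atTop)
  set ν := (volume.restrict (Set.Ioc 0 t)).prod P with hν
  have hC0 : 0 ≤ C := by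
    have h1 := (norm_nonneg _).trans (hC 0 0)
    norm_num at h1
    linarith
  have hident := fun n => F.integral_test_sub (hδ n) (hδ1 n) (hχ n) (hχc n) (hχ0 n) (hχ1 n)
    (hC n) ht
  set φ : ℕ → ℝ → EuclideanSpace ℝ (Fin d) → ℝ := fun n r x => χ n x * truncLog (δ n) (h r x)
    with hφdef
  have hφ_cont : ∀ n r, Continuous (φ n r) := fun n r =>
    (hχ n).continuous.mul ((F.truncLog_cont (hδ n)).comp (Continuous.prodMk_right r))
  have hprob : ∀ r, IsProbabilityMeasure (densMeasure fun x => π x * h r x) := fun r => by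
    rw [← F.law r]
    exact Measure.isProbabilityMeasure_map (F.X_meas_slice r).aemeasurable
  have hφ_int : ∀ n r, Integrable (φ n r) (densMeasure fun x => π x * h r x) := by
    intro n r
    refine Integrable.of_bound (C := -Real.log (δ n)) (hφ_cont n r).aestronglyMeasurable
      (Eventually.of_forall fun x => ?_)
    have h1 := abs_truncLog_le_neg_log (hδ n) (hδ1 n) (F.h_nonneg r x)
    rw [Real.norm_eq_abs, abs_mul, abs_of_nonneg (hχ0 n _)]
    exact (mul_le_of_le_one_left (abs_nonneg _) (hχ1 n _)).trans h1
  have hφ_lim : ∀ r, ∀ᵐ x ∂(densMeasure fun x => π x * h r x),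
      Tendsto (fun n => φ n r x) atTop (𝓝 (Real.log (h r x))) := fun r =>
    (F.ae_h_pos r).mono fun x hx => by
      simpa using (hχlim x).mul (tendsto_truncLog hx hδlim)
  have hφ_le : ∀ n r, ∀ᵐ x ∂(densMeasure fun x => π x * h r x),
      ‖φ n r x‖ ≤ ‖Real.log (h r x)‖ := fun n r =>
    (F.ae_h_pos r).mono fun x hx => by
      have h1 := Set.abs_sub_left_of_mem_uIcc (truncLog_mem_uIcc (hδ n) (hδ1 n) hx)
      rw [sub_zero, sub_zero] at h1
      rw [Real.norm_eq_abs, Real.norm_eq_abs, hφdef, abs_mul, abs_of_nonneg (hχ0 n _)]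
      exact (mul_le_of_le_one_left (abs_nonneg _) (hχ1 n _)).trans h1
  have hφ_low : ∀ n r, ∀ᵐ x ∂(densMeasure fun x => π x * h r x),
      -max (-Real.log (h r x)) 0 ≤ φ n r x := fun n r =>
    (F.ae_h_pos r).mono fun x hx => by
      have h1 := truncLog_mem_uIcc (hδ n) (hδ1 n) hx
      have h2 := hχ0 n x
      have h3 := hχ1 n x
      show _ ≤ χ n x * truncLog (δ n) (h r x)
      rcases Set.mem_uIcc.1 h1 with ⟨h4, h5⟩ | ⟨h4, h5⟩
      · linarith [mul_nonneg h2 h4, le_max_right (-Real.log (h r x)) 0]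
      · have : -max (-Real.log (h r x)) 0 ≤ Real.log (h r x) := by
          linarith [le_max_left (-Real.log (h r x)) 0]
        nlinarith
  -- the contribution of the time derivative
  have lim1 : Tendsto (fun n => ∫ x, χ n x *
      (π x * (truncLogPrim (δ n) (h t x) - truncLogPrim (δ n) (h 0 x)))) atTop (𝓝 0) := by
    -- Conservation of mass is what cancels the time derivative of `h`.
    have hzero : ∫ x, (π x * h t x - π x * h 0 x) = 0 := by
      rw [integral_sub (F.density t) (F.density 0), F.mass, F.mass, sub_self]
    rw [show 𝓝 (0:ℝ) = 𝓝 (∫ x, (π x * h t x - π x * h 0 x)) by rw [hzero]]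
    refine tendsto_integral_of_dominated_convergence
      (fun x => 2 * (π x * h t x) + 2 * (π x * h 0 x)) (fun n => ?_)
      (((F.density t).const_mul 2).add ((F.density 0).const_mul 2))
      (fun n => Eventually.of_forall fun x => ?_) (Eventually.of_forall fun x => ?_)
    · have hm : ∀ r, Measurable fun x => truncLogPrim (δ n) (h r x) := fun r => by
        have := (F.h_cont_slice r).measurable
        unfold truncLogPrim
        fun_prop
      exact ((hχ n).continuous.measurable.mul
        (F.cont.measurable.mul ((hm t).sub (hm 0)))).aestronglyMeasurable
    · have h1 := abs_truncLogPrim_le (hδ n) (F.h_nonneg t x)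
      have h2 := abs_truncLogPrim_le (hδ n) (F.h_nonneg 0 x)
      rw [Real.norm_eq_abs, abs_mul, abs_of_nonneg (hχ0 n x), abs_mul, abs_of_pos (F.pos x)]
      refine (mul_le_of_le_one_left (by have := F.pos x; positivity) (hχ1 n x)).trans ?_
      calc _ ≤ π x * (2 * h t x + 2 * h 0 x) := by
            have := (F.pos x).le
            gcongr
            exact (abs_sub _ _).trans (add_le_add h1 h2)
        _ = _ := by ring
    · have := (hχlim x).mul (((tendsto_truncLogPrim (F.h_nonneg t x) hδlim hδ).sub
        (tendsto_truncLogPrim (F.h_nonneg 0 x) hδlim hδ)).const_mul (π x))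
      simpa [mul_sub] using this
  -- the contribution of the cutoff
  have lim2 : Tendsto (fun n => ∫ z : ℝ × Ω, cutoffTerm (δ n) (χ n) h b z.1 (X z.1 z.2) ∂ν)
      atTop (𝓝 0) := by
    set M := ∫ z : ℝ × Ω, (1 + ‖b z.1 (X z.1 z.2)‖ ^ 2) ∂ν with hM
    have hM0 : 0 ≤ M := integral_nonneg fun z => by positivity
    have hlim : Tendsto (fun n => C * M * δ n) atTop (𝓝 0) := by
      simpa using hδlim.const_mul (C * M)
    refine squeeze_zero_norm (fun n => ?_) hlim
    have h1 : ‖∫ z : ℝ × Ω, cutoffTerm (δ n) (χ n) h b z.1 (X z.1 z.2) ∂ν‖ ≤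
        ∫ z : ℝ × Ω, -Real.log (δ n) * (C / ((n : ℝ) + 2) ^ 2) *
          (1 + ‖b z.1 (X z.1 z.2)‖ ^ 2) ∂ν :=
      norm_integral_le_of_norm_le ((F.integrable_one_add_velocity_sq t).const_mul _)
        (Eventually.of_forall fun z => F.abs_cutoffTerm_le (hδ n) (hδ1 n) (hC n) _ _)
    refine h1.trans ?_
    rw [integral_const_mul, ← hM]
    have h2 : (0:ℝ) < (n : ℝ) + 2 := by positivity
    -- Against the gradient bound `C / (n + 2) ^ 2`, this crude estimate still leaves a factor `δ
    -- n`.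
    have h3 : -Real.log (δ n) ≤ (n : ℝ) + 2 := by
      rw [hδdef, Real.log_inv, neg_neg]
      linarith [Real.log_le_sub_one_of_pos h2]
    calc _ ≤ ((n : ℝ) + 2) * (C / ((n : ℝ) + 2) ^ 2) * M := by gcongr
      _ = C * M * δ n := by rw [hδdef]; field_simp
  -- the contribution of the relative score
  have hpair : Integrable (fun z : ℝ × Ω => inner ℝ ((h z.1 (X z.1 z.2))⁻¹ • g z.1 (X z.1 z.2))
      (b z.1 (X z.1 z.2))) ν :=
    ((F.score_sq t).add (F.velocity_sq t)).mono'
      (F.pairing_meas.comp F.joint_meas).aestronglyMeasurable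
      (Eventually.of_forall fun z => (norm_inner_le_norm _ _).trans
        (norm_mul_norm_le_sq_add_sq _ _))
  have lim3 : Tendsto (fun n => ∫ z : ℝ × Ω, scoreTerm (δ n) (χ n) h g b z.1 (X z.1 z.2) ∂ν)
      atTop (𝓝 (∫ z : ℝ × Ω, inner ℝ ((h z.1 (X z.1 z.2))⁻¹ • g z.1 (X z.1 z.2))
        (b z.1 (X z.1 z.2)) ∂ν)) := by
    refine tendsto_integral_of_dominated_convergence _ (fun n =>
        ((F.scoreTerm_meas (hδ n) (hχ n)).comp F.joint_meas).aestronglyMeasurable)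
      ((F.score_sq t).add (F.velocity_sq t))
      (fun n => Eventually.of_forall fun z => F.abs_scoreTerm_le (hδ n) (hχ0 n) (hχ1 n) _ _)
      (Eventually.of_forall fun z => ?_)
    unfold scoreTerm
    rcases (F.h_nonneg z.1 (X z.1 z.2)).eq_or_lt with h0 | h0
    · simp [← h0]
    · simpa using ((hχlim _).mul (tendsto_mul_truncLogDeriv h0 hδlim)).mul_const
        (inner ℝ ((h z.1 (X z.1 z.2))⁻¹ • g z.1 (X z.1 z.2)) (b z.1 (X z.1 z.2)))
  have hswap : ∫ z : ℝ × Ω, inner ℝ ((h z.1 (X z.1 z.2))⁻¹ • g z.1 (X z.1 z.2))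
      (b z.1 (X z.1 z.2)) ∂ν = ∫ r in (0:ℝ)..t, ∫ x, inner ℝ ((h r x)⁻¹ • g r x) (b r x)
        ∂(densMeasure fun x => π x * h r x) := by
    rw [intervalIntegral.integral_of_le ht.1, hν, integral_prod _ hpair]
    refine integral_congr_ae (Eventually.of_forall fun r => ?_)
    exact F.integral_comp r (φ := fun x => inner ℝ ((h r x)⁻¹ • g r x) (b r x))
      (F.pairing_meas.comp measurable_prodMk_left)
  have lim0 : Tendsto (fun n => ∫ x, φ n 0 x ∂(densMeasure fun x => π x * h 0 x)) atTop
      (𝓝 (∫ x, Real.log (h 0 x) ∂(densMeasure fun x => π x * h 0 x))) :=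
    tendsto_integral_of_dominated_convergence _ (fun n => (hφ_int n 0).1) h_init.norm
      (fun n => hφ_le n 0) (hφ_lim 0)
  have limt : Tendsto (fun n => ∫ x, φ n t x ∂(densMeasure fun x => π x * h t x)) atTop
      (𝓝 (∫ x, Real.log (h 0 x) ∂(densMeasure fun x => π x * h 0 x) +
        ∫ r in (0:ℝ)..t, ∫ x, inner ℝ ((h r x)⁻¹ • g r x) (b r x)
        ∂(densMeasure fun x => π x * h r x))) := by
    have := lim0.add ((lim1.add lim2).add lim3)
    rw [hswap, zero_add, zero_add] at this
    refine this.congr fun n => ?_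
    rw [← hident n]
    simp only [hφdef]
    ring
  -- The truncated entropies at time `t` converge through the identity, hence are bounded. Fatou
  -- then yields integrability of `log h_t`, and only after that can dominated convergence identify
  -- the limit.
  obtain ⟨K, hK⟩ := limt.bddAbove_range
  have hint : Integrable (fun x => Real.log (h t x)) (densMeasure fun x => π x * h t x) :=
    integrable_of_tendsto_of_integral_le (fun n => hφ_int n t) (hφ_lim t)
      (F.integrable_negPart_log t) (fun n => hφ_low n t) fun n => hK ⟨n, rfl⟩
  exact ⟨hint, tendsto_nhds_unique (tendsto_integral_of_dominated_convergence _
    (fun n => (hφ_int n t).1) hint.norm (fun n => hφ_le n t) (hφ_lim t)) limt⟩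

end IsDensityFlow

/-! ### Scores, and continuity in time of the entropy production. -/

section Scores

variable {d : ℕ} {f π : EuclideanSpace ℝ (Fin d) → ℝ}

lemma measurable_gradient (φ : EuclideanSpace ℝ (Fin d) → ℝ) : Measurable (gradient φ) :=
  (InnerProductSpace.toDual ℝ (EuclideanSpace ℝ (Fin d))).symm.continuous.measurable.comp
    (measurable_fderiv ℝ φ)

lemma measurable_score (f : EuclideanSpace ℝ (Fin d) → ℝ) : Measurable (score f) :=
  measurable_gradient _

lemma measurable_relScore (f π : EuclideanSpace ℝ (Fin d) → ℝ) : Measurable (relScore f π) :=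
  measurable_gradient _

/-- The density stays nonzero near `x`, so the logarithm splits locally, which suffices for the
gradient. -/
lemma relScore_eq_score_sub_score {x : EuclideanSpace ℝ (Fin d)} (hf : DifferentiableAt ℝ f x)
    (hπ : DifferentiableAt ℝ π x) (hfx : f x ≠ 0) (hπ0 : ∀ y, 0 < π y) :
    relScore f π x = score f x - score π x := by
  have h1 : (fun y => Real.log (f y / π y)) =ᶠ[𝓝 x]
      fun y => Real.log (f y) - Real.log (π y) := by
    filter_upwards [hf.continuousAt.eventually_ne hfx] with y hy
    exact Real.log_div hy (hπ0 y).ne'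
  rw [relScore, score, score, gradient, gradient, gradient, h1.fderiv_eq,
    fderiv_fun_sub (hf.log hfx) (hπ.log (hπ0 x).ne'), map_sub]

end Scores

/-- Integrability along a process of a function of time and state with continuous mean. -/
lemma integrable_prod_of_continuous_mean {Ω E : Type*} [MeasurableSpace Ω] [MeasurableSpace E]
    {P : Measure Ω} [IsProbabilityMeasure P] {X : ℝ → Ω → E} (hX : Measurable (Function.uncurry X))
    {w : ℝ → E → ℝ} (hw : Measurable (Function.uncurry w)) (hw0 : ∀ r x, 0 ≤ w r x)
    (hint : ∀ r, Integrable (w r) (P.map (X r)))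
    (hcont : Continuous fun r => ∫ x, w r x ∂(P.map (X r))) (t : ℝ) :
    Integrable (fun z : ℝ × Ω => w z.1 (X z.1 z.2)) ((volume.restrict (Set.Ioc 0 t)).prod P) := by
  have hXr : ∀ r, Measurable (X r) := fun r => hX.comp measurable_prodMk_left
  have hwr : ∀ r, Measurable (w r) := fun r => hw.comp measurable_prodMk_left
  have hm : Measurable (fun z : ℝ × Ω => w z.1 (X z.1 z.2)) := hw.comp (measurable_fst.prodMk hX)
  rw [integrable_prod_iff hm.aestronglyMeasurable]
  refine ⟨Eventually.of_forall fun r => (hint r).comp_measurable (hXr r), ?_⟩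
  have : (fun r => ∫ ω, ‖w r (X r ω)‖ ∂P) = fun r => ∫ x, w r x ∂(P.map (X r)) := by
    funext r
    rw [integral_map (hXr r).aemeasurable (hwr r).aestronglyMeasurable]
    exact integral_congr_ae (Eventually.of_forall fun ω => Real.norm_of_nonneg (hw0 _ _))
  show Integrable (fun r => ∫ ω, ‖w r (X r ω)‖ ∂P) _
  rw [this]
  exact hcont.integrableOn_Ioc

section Setting

variable {d : ℕ} {T : ℝ} {π : EuclideanSpace ℝ (Fin d) → ℝ}
  {s : ℝ → EuclideanSpace ℝ (Fin d) → EuclideanSpace ℝ (Fin d)}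
  {f : ℝ → EuclideanSpace ℝ (Fin d) → ℝ}

lemma contDiffOn_ratio (hπ_pos : ∀ x, 0 < π x) (hπ_smooth : ContDiff ℝ 1 π)
    (hf_smooth : ContDiffOn ℝ 1 (Function.uncurry f) (Set.Icc 0 T ×ˢ Set.univ)) :
    ContDiffOn ℝ 1 (Function.uncurry fun t x => f t x / π x) (Set.Icc 0 T ×ˢ Set.univ) :=
  hf_smooth.div (hπ_smooth.comp contDiff_snd).contDiffOn fun q _ => (hπ_pos q.2).ne'

lemma continuous_slice
    (hf_smooth : ContDiffOn ℝ 1 (Function.uncurry f) (Set.Icc 0 T ×ˢ Set.univ))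
    {t : ℝ} (ht : t ∈ Set.Icc 0 T) : Continuous (f t) :=
  continuous_iff_continuousAt.2 fun x => (hasFDerivAt_slice hf_smooth ht x).continuousAt

/-- Continuity in time of the score at points of positive density. -/
lemma tendsto_score (hT : 0 < T)
    (hf_smooth : ContDiffOn ℝ 1 (Function.uncurry f) (Set.Icc 0 T ×ˢ Set.univ))
    {q : ℕ → ℝ} {t : ℝ} {x : EuclideanSpace ℝ (Fin d)}
    (hq : Tendsto q atTop (𝓝[Set.Icc 0 T] t)) (hq_mem : ∀ n, q n ∈ Set.Icc 0 T)
    (ht : t ∈ Set.Icc 0 T) (hx : 0 < f t x) :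
    Tendsto (fun n => score (f (q n)) x) atTop (𝓝 (score (f t) x)) := by
  have hqx : Tendsto (fun n => (q n, x)) atTop (𝓝[Set.Icc 0 T ×ˢ Set.univ] (t, x)) := by
    rw [nhdsWithin_prod_eq, nhdsWithin_univ]
    exact hq.prodMk tendsto_const_nhds
  have hmem : (t, x) ∈ Set.Icc 0 T ×ˢ (Set.univ : Set (EuclideanSpace ℝ (Fin d))) :=
    ⟨ht, trivial⟩
  have lf : Tendsto (fun n => f (q n) x) atTop (𝓝 (f t x)) :=
    (hf_smooth.continuousOn _ hmem).tendsto.comp hqx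
  have lg : Tendsto (fun n => gradient (f (q n)) x) atTop (𝓝 (gradient (f t) x)) :=
    (continuousOn_gradient_slice hT hf_smooth _ hmem).tendsto.comp hqx
  have escore : ∀ r ∈ Set.Icc 0 T, 0 < f r x →
      score (f r) x = (f r x)⁻¹ • gradient (f r) x := fun r hr h =>
    gradient_log (hasFDerivAt_slice hf_smooth hr x).differentiableAt h.ne'
  rw [escore t ht hx]
  refine ((lf.inv₀ hx.ne').smul lg).congr' ?_
  filter_upwards [lf.eventually (lt_mem_nhds hx)] with n hn
  exact (escore _ (hq_mem n) hn).symm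

/-- Continuity in time of the pairing of the score error with the relative score. -/
lemma continuous_integral_pairing (hT : 0 < T) (hπ_pos : ∀ x, 0 < π x)
    (hπ_smooth : ContDiff ℝ 1 π)
    (hs_meas : ∀ t ∈ Set.Icc 0 T, Measurable (s t))
    (hs_cont : ∀ x, ContinuousOn (fun t => s t x) (Set.Icc 0 T))
    (hf_nonneg : ∀ t ∈ Set.Icc 0 T, ∀ x, 0 ≤ f t x)
    (hf_smooth : ContDiffOn ℝ 1 (Function.uncurry f) (Set.Icc 0 T ×ˢ Set.univ))
    (hF_fin : ∀ t ∈ Set.Icc 0 T, Integrable (fun x => ‖relScore (f t) π x‖ ^ 2)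
      (densMeasure (f t)))
    (hF_cont : ContinuousOn (fun t => relFisher (f t) π) (Set.Icc 0 T))
    (hL_fin : ∀ t ∈ Set.Icc 0 T, Integrable (fun x => ‖s t x - score (f t) x‖ ^ 2)
      (densMeasure (f t)))
    (hL_cont : ContinuousOn (fun t => scoreLoss (s t) (f t)) (Set.Icc 0 T))
    {p : ℝ → ℝ} (hp : Continuous p) (hp_mem : ∀ r, p r ∈ Set.Icc 0 T) :
    Continuous fun r => ∫ x, inner ℝ (score (f (p r)) x - s (p r) x) (relScore (f (p r)) π x)
      ∂(densMeasure (f (p r))) := by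
  have hh := contDiffOn_ratio hπ_pos hπ_smooth hf_smooth
  have hfm : ∀ r, Measurable (f (p r)) := fun r => (continuous_slice hf_smooth (hp_mem r)).measurable
  have hf0 := fun r => hf_nonneg (p r) (hp_mem r)
  rw [continuous_iff_seqContinuous]
  intro r r₀ hr
  -- The factor `√f` moves the fields for all times into one space `L²(dx)`, where their squared
  -- norms are the loss and the Fisher information.
  set a : ℝ → EuclideanSpace ℝ (Fin d) → EuclideanSpace ℝ (Fin d) := fun r x =>
    Real.sqrt (f (p r) x) • (score (f (p r)) x - s (p r) x) with ha
  set c : ℝ → EuclideanSpace ℝ (Fin d) → EuclideanSpace ℝ (Fin d) := fun r x =>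
    Real.sqrt (f (p r) x) • relScore (f (p r)) π x with hc
  have ha_sq : ∀ r x, ‖a r x‖ ^ 2 = f (p r) x * ‖s (p r) x - score (f (p r)) x‖ ^ 2 := by
    intro r x
    rw [ha, norm_smul, mul_pow, Real.norm_of_nonneg (Real.sqrt_nonneg _), Real.sq_sqrt (hf0 r x),
      norm_sub_rev]
  have hc_sq : ∀ r x, ‖c r x‖ ^ 2 = f (p r) x * ‖relScore (f (p r)) π x‖ ^ 2 := by
    intro r x
    rw [hc, norm_smul, mul_pow, Real.norm_of_nonneg (Real.sqrt_nonneg _), Real.sq_sqrt (hf0 r x)]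
  have hac : ∀ r x, inner ℝ (a r x) (c r x) =
      f (p r) x * inner ℝ (score (f (p r)) x - s (p r) x) (relScore (f (p r)) π x) := by
    intro r x
    rw [ha, hc, real_inner_smul_left, real_inner_smul_right, ← mul_assoc,
      Real.mul_self_sqrt (hf0 r x)]
  have ha_mem : ∀ r, MemLp (a r) 2 volume := by
    intro r
    have hm : Measurable (a r) := (hfm r).sqrt.smul
      ((measurable_score _).sub (hs_meas _ (hp_mem r)))
    rw [memLp_two_iff_integrable_sq_norm hm.aestronglyMeasurable]
    simp_rw [ha_sq]
    exact (integrable_densMeasure_iff (hfm r) (hf0 r)).1 (hL_fin _ (hp_mem r))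
  have hc_mem : ∀ r, MemLp (c r) 2 volume := by
    intro r
    have hm : Measurable (c r) := (hfm r).sqrt.smul (measurable_relScore _ _)
    rw [memLp_two_iff_integrable_sq_norm hm.aestronglyMeasurable]
    simp_rw [hc_sq]
    exact (integrable_densMeasure_iff (hfm r) (hf0 r)).1 (hF_fin _ (hp_mem r))
  have key : ∀ r, ∫ x, inner ℝ (score (f (p r)) x - s (p r) x) (relScore (f (p r)) π x)
      ∂(densMeasure (f (p r))) = ∫ x, inner ℝ (a r x) (c r x) := by
    intro r
    rw [integral_densMeasure (hfm r) (hf0 r)]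
    simp_rw [hac]
  have ha_int : ∀ r, ∫ x, ‖a r x‖ ^ 2 = scoreLoss (s (p r)) (f (p r)) := by
    intro r
    rw [scoreLoss, integral_densMeasure (hfm r) (hf0 r)]
    simp_rw [ha_sq]
  have hc_int : ∀ r, ∫ x, ‖c r x‖ ^ 2 = relFisher (f (p r)) π := by
    intro r
    rw [relFisher, integral_densMeasure (hfm r) (hf0 r)]
    simp_rw [hc_sq]
  have hpr : Tendsto (fun n => p (r n)) atTop (𝓝[Set.Icc 0 T] p r₀) :=
    tendsto_nhdsWithin_iff.2 ⟨(hp.tendsto r₀).comp hr, Eventually.of_forall fun n => hp_mem _⟩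
  simp only [Function.comp_def, key]
  refine tendsto_integral_inner_of_tendsto_integral_norm_sq (ha_mem r₀) (hc_mem r₀)
    (fun n => ha_mem (r n)) (fun n => hc_mem (r n)) (Eventually.of_forall fun x => ?_) ?_ ?_
  -- Where the limiting density vanishes the scores need not converge, but both weighted limits are
  -- `0`, which the criterion allows.
  · rcases (hf0 r₀ x).eq_or_lt with h0 | h0
    · left
      simp [ha, hc, ← h0]
    right
    have hpx : Tendsto (fun n => (p (r n), x)) atTop
        (𝓝[Set.Icc 0 T ×ˢ Set.univ] (p r₀, x)) := by
      rw [nhdsWithin_prod_eq, nhdsWithin_univ]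
      exact hpr.prodMk tendsto_const_nhds
    have hmem : (p r₀, x) ∈ Set.Icc 0 T ×ˢ (Set.univ : Set (EuclideanSpace ℝ (Fin d))) :=
      ⟨hp_mem r₀, trivial⟩
    have lf : Tendsto (fun n => f (p (r n)) x) atTop (𝓝 (f (p r₀) x)) :=
      (hf_smooth.continuousOn _ hmem).tendsto.comp hpx
    have ls : Tendsto (fun n => s (p (r n)) x) atTop (𝓝 (s (p r₀) x)) :=
      (hs_cont x _ (hp_mem r₀)).tendsto.comp hpr
    have hπx := hπ_pos x
    have lscore := tendsto_score hT hf_smooth hpr (fun n => hp_mem (r n)) (hp_mem r₀) h0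
    -- The relative score is by definition the score of the ratio `f / π`.
    have lrel := tendsto_score hT hh hpr (fun n => hp_mem (r n)) (hp_mem r₀)
      (div_pos h0 (hπ_pos x))
    have lsqrt : Tendsto (fun n => Real.sqrt (f (p (r n)) x)) atTop
        (𝓝 (Real.sqrt (f (p r₀) x))) := lf.sqrt
    exact ⟨lsqrt.smul (lscore.sub ls), lsqrt.smul lrel⟩
  · simp_rw [ha_int]
    exact (hL_cont _ (hp_mem r₀)).tendsto.comp hpr
  · simp_rw [hc_int]
    exact (hF_cont _ (hp_mem r₀)).tendsto.comp hpr

end Setting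

/-! ### Reduction of the given dynamics to a density flow. -/

/-- A version of the process that is jointly measurable and constant in time outside `[0, T]`. -/
lemma exists_measurable_version {d : ℕ} {Ω : Type*} [MeasurableSpace Ω] {P : Measure Ω} {T : ℝ}
    {X : ℝ → Ω → EuclideanSpace ℝ (Fin d)}
    {v : ℝ → EuclideanSpace ℝ (Fin d) → EuclideanSpace ℝ (Fin d)}
    (hX_meas : ∀ t ∈ Set.Icc 0 T, Measurable (X t))
    (hX_ode : ∀ᵐ ω ∂P, ∀ t ∈ Set.Icc 0 T,
      HasDerivWithinAt (fun τ => X τ ω) (v t (X t ω)) (Set.Icc 0 T) t)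
    {p : ℝ → ℝ} (hp : Continuous p) (hp_mem : ∀ r, p r ∈ Set.Icc 0 T)
    (hp_eq : ∀ t ∈ Set.Icc 0 T, p t = t) :
    ∃ Y : ℝ → Ω → EuclideanSpace ℝ (Fin d), Measurable (Function.uncurry Y) ∧
      (∀ r, Y r =ᵐ[P] X (p r)) ∧
      ∀ᵐ ω ∂P, ∀ t ∈ Set.Icc 0 T,
        HasDerivWithinAt (fun τ => Y τ ω) (v t (Y t ω)) (Set.Icc 0 T) t := by
  classical
  -- Resetting the paths to `0` off a measurable set of full measure makes every path continuous;
  -- with measurability at each time this gives joint measurability.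
  obtain ⟨A, hA, hA_meas, hA_sub⟩ := hX_ode.exists_measurable_mem
  refine ⟨fun r ω => if ω ∈ A then X (p r) ω else 0, ?_, fun r => ?_, ?_⟩
  · refine measurable_uncurry_of_continuous_of_measurable (fun ω => ?_) fun r =>
      Measurable.ite hA_meas (hX_meas _ (hp_mem r)) measurable_const
    by_cases hω : ω ∈ A
    · simp only [hω, if_true]
      have : ContinuousOn (fun τ => X τ ω) (Set.Icc 0 T) := fun t ht =>
        (hA_sub ω hω t ht).continuousWithinAt
      exact this.comp_continuous hp hp_mem
    · simp only [hω, if_false]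
      exact continuous_const
  · filter_upwards [hA] with ω hω
    simp [hω]
  · filter_upwards [hA] with ω hω t ht
    simp only [hω, if_true, hp_eq t ht]
    exact (hA_sub ω hω t ht).congr (fun τ hτ => by rw [hp_eq τ hτ]) (by rw [hp_eq t ht])

/-- Square-integrability of the velocity `b` is derived from `b + ∇log(f/π) = ∇log f - s`: the right
side is controlled by the loss and the relative score by the Fisher information. -/
lemma isDensityFlow_of_ode {d : ℕ} {T : ℝ} (hT : 0 < T)
    {π : EuclideanSpace ℝ (Fin d) → ℝ}
    (hπ_pos : ∀ x, 0 < π x) (hπ_dens : IsProbDensity π) (hπ_smooth : ContDiff ℝ 1 π)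
    {s : ℝ → EuclideanSpace ℝ (Fin d) → EuclideanSpace ℝ (Fin d)}
    (hs_meas : ∀ t ∈ Set.Icc 0 T, Measurable (s t))
    (hs_cont : ∀ x, ContinuousOn (fun t => s t x) (Set.Icc 0 T))
    {Ω : Type*} [MeasurableSpace Ω] {P : Measure Ω} [IsProbabilityMeasure P]
    {Y : ℝ → Ω → EuclideanSpace ℝ (Fin d)} (hY_meas : Measurable (Function.uncurry Y))
    (hY_ode : ∀ᵐ ω ∂P, ∀ t ∈ Set.Icc 0 T,
      HasDerivWithinAt (fun τ => Y τ ω) (score π (Y t ω) - s t (Y t ω)) (Set.Icc 0 T) t)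
    {f : ℝ → EuclideanSpace ℝ (Fin d) → ℝ}
    (hf_dens : ∀ t ∈ Set.Icc 0 T, IsProbDensity (f t))
    (hf_smooth : ContDiffOn ℝ 1 (Function.uncurry f) (Set.Icc 0 T ×ˢ Set.univ))
    (hF_fin : ∀ t ∈ Set.Icc 0 T, Integrable (fun x => ‖relScore (f t) π x‖ ^ 2)
      (densMeasure (f t)))
    (hF_cont : ContinuousOn (fun t => relFisher (f t) π) (Set.Icc 0 T))
    (hL_fin : ∀ t ∈ Set.Icc 0 T, Integrable (fun x => ‖s t x - score (f t) x‖ ^ 2)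
      (densMeasure (f t)))
    (hL_cont : ContinuousOn (fun t => scoreLoss (s t) (f t)) (Set.Icc 0 T))
    {p : ℝ → ℝ} (hp : Continuous p) (hp_mem : ∀ r, p r ∈ Set.Icc 0 T)
    (hp_eq : ∀ t ∈ Set.Icc 0 T, p t = t)
    (hY_law : ∀ r, P.map (Y r) = densMeasure (f (p r))) :
    IsDensityFlow T π (fun r x => f (p r) x / π x)
      (fun r => timeDeriv T (fun t x => f t x / π x) (p r))
      (fun r => gradient fun x => f (p r) x / π x)
      (fun r x => score π x - s (p r) x) P Y := by
  have hh := contDiffOn_ratio hπ_pos hπ_smooth hf_smooth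
  have hq : Continuous fun q : ℝ × EuclideanSpace ℝ (Fin d) => (p q.1, q.2) :=
    (hp.comp continuous_fst).prodMk continuous_snd
  have hq_mem : ∀ q : ℝ × EuclideanSpace ℝ (Fin d), (p q.1, q.2) ∈ Set.Icc 0 T ×ˢ Set.univ :=
    fun q => ⟨hp_mem q.1, trivial⟩
  have hmul : ∀ r, (fun x => π x * (f (p r) x / π x)) = f (p r) := fun r => by
    funext x
    exact mul_div_cancel₀ _ (hπ_pos x).ne'
  have hfm : ∀ r, Measurable (f (p r)) := fun r => (continuous_slice hf_smooth (hp_mem r)).measurable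
  have hh_cont : Continuous (Function.uncurry fun r x => f (p r) x / π x) :=
    hh.continuousOn.comp_continuous hq hq_mem
  have hg_cont : Continuous (Function.uncurry fun r => gradient fun x => f (p r) x / π x) :=
    (continuousOn_gradient_slice hT hh).comp_continuous hq hq_mem
  have hs_meas' : Measurable (Function.uncurry fun r x => s (p r) x) :=
    measurable_uncurry_of_continuous_of_measurable
      (fun x => (hs_cont x).comp_continuous hp hp_mem) fun r => hs_meas _ (hp_mem r)
  have hb_meas : Measurable (Function.uncurry fun r x => score π x - s (p r) x) :=
    ((measurable_score π).comp measurable_snd).sub hs_meas'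
  have hu_meas : Measurable (Function.uncurry fun r x =>
      (f (p r) x / π x)⁻¹ • gradient (fun x => f (p r) x / π x) x) :=
    hh_cont.measurable.inv.smul hg_cont.measurable
  have hu : ∀ r, ∀ᵐ x ∂(densMeasure (f (p r))),
      (f (p r) x / π x)⁻¹ • gradient (fun x => f (p r) x / π x) x = relScore (f (p r)) π x :=
    fun r => (ae_densMeasure_pos (hfm r)).mono fun x hx =>
      (gradient_log (hasFDerivAt_slice hh (hp_mem r) x).differentiableAt
        (div_pos hx (hπ_pos x)).ne').symm
  have hub : ∀ r, ∀ᵐ x ∂(densMeasure (f (p r))),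
      ‖(score π x - s (p r) x) +
        (f (p r) x / π x)⁻¹ • gradient (fun x => f (p r) x / π x) x‖ ^ 2 =
      ‖s (p r) x - score (f (p r)) x‖ ^ 2 := by
    intro r
    filter_upwards [hu r, ae_densMeasure_pos (hfm r)] with x hx hpos
    rw [hx, relScore_eq_score_sub_score
      (hasFDerivAt_slice hf_smooth (hp_mem r) x).differentiableAt
      (hπ_smooth.differentiable one_ne_zero x) hpos.ne' hπ_pos, norm_sub_rev]
    congr 2
    abel
  have hu_sq : ∀ t, Integrable (fun z : ℝ × Ω => ‖(f (p z.1) (Y z.1 z.2) / π (Y z.1 z.2))⁻¹ •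
      gradient (fun x => f (p z.1) x / π x) (Y z.1 z.2)‖ ^ 2)
      ((volume.restrict (Set.Ioc 0 t)).prod P) := by
    refine integrable_prod_of_continuous_mean hY_meas (w := fun r x =>
      ‖(f (p r) x / π x)⁻¹ • gradient (fun x => f (p r) x / π x) x‖ ^ 2)
      (hu_meas.norm.pow_const 2) (fun r x => by positivity) (fun r => ?_) ?_
    · rw [hY_law]
      exact (hF_fin _ (hp_mem r)).congr ((hu r).mono fun x hx => by simp only [hx])
    · refine (hF_cont.comp_continuous hp hp_mem).congr fun r => ?_
      rw [hY_law]
      exact integral_congr_ae ((hu r).mono fun x hx => by simp only [hx])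
  have hub_sq : ∀ t, Integrable (fun z : ℝ × Ω => ‖(score π (Y z.1 z.2) - s (p z.1) (Y z.1 z.2)) +
      (f (p z.1) (Y z.1 z.2) / π (Y z.1 z.2))⁻¹ •
      gradient (fun x => f (p z.1) x / π x) (Y z.1 z.2)‖ ^ 2)
      ((volume.restrict (Set.Ioc 0 t)).prod P) := by
    refine integrable_prod_of_continuous_mean hY_meas (w := fun r x =>
      ‖(score π x - s (p r) x) +
        (f (p r) x / π x)⁻¹ • gradient (fun x => f (p r) x / π x) x‖ ^ 2)
      ((hb_meas.add hu_meas).norm.pow_const 2) (fun r x => by positivity) (fun r => ?_) ?_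
    · rw [hY_law]
      exact (hL_fin _ (hp_mem r)).congr ((hub r).mono fun x hx => hx.symm)
    · refine (hL_cont.comp_continuous hp hp_mem).congr fun r => ?_
      rw [hY_law]
      exact integral_congr_ae ((hub r).mono fun x hx => hx.symm)
  refine
    { pos := hπ_pos
      cont := hπ_smooth.continuous
      integrable := hπ_dens.2.1
      h_nonneg := fun r x => div_nonneg ((hf_dens _ (hp_mem r)).1 x) (hπ_pos x).le
      h_cont := hh_cont
      k_cont := (continuousOn_timeDeriv hT hh).comp_continuous hq hq_mem
      g_cont := hg_cont
      g_eq_zero := fun r x hx => gradient_eq_zero_of_nonneg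
        (fun y => div_nonneg ((hf_dens _ (hp_mem r)).1 y) (hπ_pos y).le) hx
      b_meas := hb_meas
      X_meas := hY_meas
      chain := fun t ht Z Z' hZ => ?_
      ode := ?_
      law := fun r => by rw [hY_law, hmul]
      density := fun r => by
        rw [hmul]
        exact (hf_dens _ (hp_mem r)).2.1
      mass := fun r => by
        rw [hmul]
        exact (hf_dens _ (hp_mem r)).2.2
      score_sq := hu_sq
      velocity_sq := fun t => ?_ }
  · have h1 := hasDerivWithinAt_along_curve hh ht hZ
    simp only [hp_eq t ht]
    exact h1.congr (fun τ hτ => by rw [hp_eq τ hτ]) (by rw [hp_eq t ht])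
  · filter_upwards [hY_ode] with ω hω t ht
    rw [hp_eq t ht]
    exact hω t ht
  · refine (((hub_sq t).const_mul 2).add ((hu_sq t).const_mul 2)).mono'
      ((hb_meas.comp (measurable_fst.prodMk hY_meas)).norm.pow_const 2).aestronglyMeasurable
      (Eventually.of_forall fun z => ?_)
    have key : ∀ a c : EuclideanSpace ℝ (Fin d), ‖a‖ ^ 2 ≤ 2 * ‖a + c‖ ^ 2 + 2 * ‖c‖ ^ 2 := by
      intro a c
      have h1 : ‖a‖ ≤ ‖a + c‖ + ‖c‖ := by simpa using norm_sub_le (a + c) c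
      nlinarith [sq_nonneg (‖a + c‖ - ‖c‖), norm_nonneg a]
    rw [Real.norm_of_nonneg (by positivity)]
    exact key _ _

end ScoreDynamics

/-! ### The dissipation formula. -/

open ScoreDynamics MeasureTheory Filter Topology in
theorem mainTheorem2
    {d : ℕ} {T : ℝ} (hT : 0 < T)
    -- the target density
    (π : EuclideanSpace ℝ (Fin d) → ℝ)
    (hπ_pos : ∀ x, 0 < π x) (hπ_dens : ScoreDynamics.IsProbDensity π) (hπ_smooth : ContDiff ℝ 1 π)
    -- the time-dependent vector field
    (s : ℝ → EuclideanSpace ℝ (Fin d) → EuclideanSpace ℝ (Fin d))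
    (hs_meas : ∀ t ∈ Set.Icc 0 T, Measurable (s t))
    (hs_cont : ∀ x, ContinuousOn (fun t => s t x) (Set.Icc 0 T))
    -- the random trajectories
    {Ω : Type*} [MeasurableSpace Ω] (P : MeasureTheory.Measure Ω)
    [MeasureTheory.IsProbabilityMeasure P]
    (X : ℝ → Ω → EuclideanSpace ℝ (Fin d))
    (hX_meas : ∀ t ∈ Set.Icc 0 T, Measurable (X t))
    (hX_ode : ∀ᵐ ω ∂P, ∀ t ∈ Set.Icc 0 T,
      HasDerivWithinAt (fun τ => X τ ω)
        (ScoreDynamics.score π (X t ω) - s t (X t ω)) (Set.Icc 0 T) t)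
    -- the density of the law of `X t`
    (f : ℝ → EuclideanSpace ℝ (Fin d) → ℝ)
    (hf_dens : ∀ t ∈ Set.Icc 0 T, ScoreDynamics.IsProbDensity (f t))
    (hf_law : ∀ t ∈ Set.Icc 0 T, P.map (X t) = ScoreDynamics.densMeasure (f t))
    (hf_smooth : ContDiffOn ℝ 1 (fun p : ℝ × EuclideanSpace ℝ (Fin d) => f p.1 p.2)
      (Set.Icc 0 T ×ˢ Set.univ))
    -- finite initial relative entropy
    (hKL : MeasureTheory.Integrable (fun x => Real.log (f 0 x / π x))
      (ScoreDynamics.densMeasure (f 0)))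
    -- the Fisher information and the loss are finite and continuous in time
    (hF_fin : ∀ t ∈ Set.Icc 0 T, MeasureTheory.Integrable
      (fun x => ‖ScoreDynamics.relScore (f t) π x‖ ^ 2) (ScoreDynamics.densMeasure (f t)))
    (hF_cont : ContinuousOn (fun t => ScoreDynamics.relFisher (f t) π) (Set.Icc 0 T))
    (hL_fin : ∀ t ∈ Set.Icc 0 T, MeasureTheory.Integrable
      (fun x => ‖s t x - ScoreDynamics.score (f t) x‖ ^ 2) (ScoreDynamics.densMeasure (f t)))
    (hL_cont : ContinuousOn (fun t => ScoreDynamics.scoreLoss (s t) (f t)) (Set.Icc 0 T)) :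
    ∀ t ∈ Set.Icc 0 T,
      MeasureTheory.Integrable (fun x => Real.log (f t x / π x))
        (ScoreDynamics.densMeasure (f t)) ∧
      MeasureTheory.Integrable
        (fun x => inner ℝ (ScoreDynamics.score (f t) x - s t x)
          (ScoreDynamics.relScore (f t) π x)) (ScoreDynamics.densMeasure (f t)) ∧
      ∃ D : ℝ,
        HasDerivWithinAt (fun τ => ScoreDynamics.relEntropy (f τ) π) D (Set.Icc 0 T) t ∧
        -D = ScoreDynamics.relFisher (f t) π
          - ∫ x, inner ℝ (ScoreDynamics.score (f t) x - s t x)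
              (ScoreDynamics.relScore (f t) π x) ∂(ScoreDynamics.densMeasure (f t)) ∧
        -D ≥ (1 / 2) * ScoreDynamics.relFisher (f t) π
          - (1 / 2) * ScoreDynamics.scoreLoss (s t) (f t) ∧
        (ScoreDynamics.scoreLoss (s t) (f t) ≤ (1 / 2) * ScoreDynamics.relFisher (f t) π →
          -D ≥ (1 / 4) * ScoreDynamics.relFisher (f t) π) := by
  have hf_nonneg : ∀ t ∈ Set.Icc 0 T, ∀ x, 0 ≤ f t x := fun t ht => (hf_dens t ht).1
  have hf_smooth' : ContDiffOn ℝ 1 (Function.uncurry f) (Set.Icc 0 T ×ˢ Set.univ) := hf_smooth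
  have hh := contDiffOn_ratio hπ_pos hπ_smooth hf_smooth'
  -- Time is clamped to `[0, T]`, so that all data extend continuously or measurably to the whole
  -- line.
  obtain ⟨p, hp, hp_mem, hp_eq⟩ : ∃ p : ℝ → ℝ, Continuous p ∧ (∀ r, p r ∈ Set.Icc 0 T) ∧
      ∀ t ∈ Set.Icc 0 T, p t = t :=
    ⟨fun r => (Set.projIcc 0 T hT.le r : ℝ), continuous_subtype_val.comp continuous_projIcc,
      fun r => (Set.projIcc 0 T hT.le r).2, fun t ht => by simp only [Set.projIcc_of_mem hT.le ht]⟩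
  obtain ⟨Y, hY_meas, hY_ae, hY_ode⟩ := exists_measurable_version
    (v := fun t x => score π x - s t x) hX_meas hX_ode hp hp_mem hp_eq
  have hY_law : ∀ r, P.map (Y r) = densMeasure (f (p r)) := fun r => by
    rw [Measure.map_congr (hY_ae r), hf_law _ (hp_mem r)]
  have F := isDensityFlow_of_ode hT hπ_pos hπ_dens hπ_smooth hs_meas hs_cont hY_meas hY_ode
    hf_dens hf_smooth' hF_fin hF_cont hL_fin hL_cont hp hp_mem hp_eq hY_law
  have hmul : ∀ r, (fun x => π x * (f r x / π x)) = f r := fun r => by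
    funext x
    exact mul_div_cancel₀ _ (hπ_pos x).ne'
  have hfm : ∀ t ∈ Set.Icc 0 T, Measurable (f t) := fun t ht =>
    (continuous_slice hf_smooth' ht).measurable
  have hpair_memLp : ∀ t ∈ Set.Icc 0 T,
      MemLp (fun x => score (f t) x - s t x) 2 (densMeasure (f t)) ∧
      MemLp (relScore (f t) π) 2 (densMeasure (f t)) := fun t ht =>
    ⟨(memLp_two_iff_integrable_sq_norm
        ((measurable_score _).sub (hs_meas t ht)).aestronglyMeasurable).2
        (by simpa only [Pi.sub_apply, norm_sub_rev] using hL_fin t ht),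
      (memLp_two_iff_integrable_sq_norm
        (measurable_relScore _ _).aestronglyMeasurable).2 (hF_fin t ht)⟩
  have hpair_int : ∀ t ∈ Set.Icc 0 T, Integrable (fun x => inner ℝ (score (f t) x - s t x)
      (relScore (f t) π x)) (densMeasure (f t)) := fun t ht =>
    integrable_inner_of_memLp_two (hpair_memLp t ht).1 (hpair_memLp t ht).2
  -- the entropy production rate
  set J : ℝ → ℝ := fun t => ∫ x, inner ℝ (score (f t) x - s t x) (relScore (f t) π x)
    ∂(densMeasure (f t)) with hJ
  have hI_cont : Continuous fun r => J (p r) - relFisher (f (p r)) π :=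
    (continuous_integral_pairing hT hπ_pos hπ_smooth hs_meas hs_cont hf_nonneg hf_smooth'
      hF_fin hF_cont hL_fin hL_cont hp hp_mem).sub (hF_cont.comp_continuous hp hp_mem)
  have hrate : ∀ r, ∫ x, inner ℝ ((f (p r) x / π x)⁻¹ • gradient (fun x => f (p r) x / π x) x)
      (score π x - s (p r) x) ∂(densMeasure (f (p r))) = J (p r) - relFisher (f (p r)) π := by
    intro r
    rw [hJ, relFisher, ← integral_sub (hpair_int _ (hp_mem r)) (hF_fin _ (hp_mem r))]
    refine integral_congr_ae ?_
    filter_upwards [ae_densMeasure_pos (hfm _ (hp_mem r))] with x hx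
    have h1 : (f (p r) x / π x)⁻¹ • gradient (fun x => f (p r) x / π x) x =
        relScore (f (p r)) π x :=
      (gradient_log (hasFDerivAt_slice hh (hp_mem r) x).differentiableAt
        (div_pos hx (hπ_pos x)).ne').symm
    have h2 := relScore_eq_score_sub_score
      (hasFDerivAt_slice hf_smooth' (hp_mem r) x).differentiableAt
      (hπ_smooth.differentiable one_ne_zero x) hx.ne' hπ_pos
    -- The decomposition of the velocity into score error minus relative score produces the two
    -- terms of the rate.
    have h3 : score π x - s (p r) x =
        (score (f (p r)) x - s (p r) x) - relScore (f (p r)) π x := by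
      rw [h2]
      abel
    rw [h1, h3, inner_sub_right, real_inner_self_eq_norm_sq, real_inner_comm]
  have hbalance : ∀ t ∈ Set.Icc 0 T,
      Integrable (fun x => Real.log (f t x / π x)) (densMeasure (f t)) ∧
      relEntropy (f t) π = relEntropy (f 0) π +
        ∫ r in (0:ℝ)..t, (J (p r) - relFisher (f (p r)) π) := by
    intro t ht
    have h0 := hp_eq 0 ⟨le_rfl, hT.le⟩
    have := F.entropy_balance ht (by simpa only [hmul, h0] using hKL)
    simpa only [relEntropy, hmul, h0, hp_eq t ht, hrate] using this
  intro t ht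
  refine ⟨(hbalance t ht).1, hpair_int t ht, J t - relFisher (f t) π, ?_, ?_, ?_⟩
  -- The clamped rate is continuous on all of `ℝ`, so its primitive is differentiable on both sides
  -- even at `0` and `T`; restriction gives the one-sided derivatives.
  · have h1 : HasDerivAt (fun τ => ∫ r in (0:ℝ)..τ, (J (p r) - relFisher (f (p r)) π))
        (J (p t) - relFisher (f (p t)) π) t :=
      (hI_cont.integral_hasStrictDerivAt 0 t).hasDerivAt
    rw [hp_eq t ht] at h1
    exact (h1.const_add (relEntropy (f 0) π)).hasDerivWithinAt.congr
      (fun τ hτ => (hbalance τ hτ).2) (hbalance t ht).2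
  · rw [hJ]
    ring
  -- Young's inequality under the integral.
  · have hJ_le : J t ≤ (1 / 2) * scoreLoss (s t) (f t) + (1 / 2) * relFisher (f t) π := by
      rw [hJ, scoreLoss, relFisher, ← integral_const_mul, ← integral_const_mul,
        ← integral_add ((hL_fin t ht).const_mul _) ((hF_fin t ht).const_mul _)]
      refine integral_mono (hpair_int t ht)
        (((hL_fin t ht).const_mul _).add ((hF_fin t ht).const_mul _)) fun x => ?_
      have h1 := real_inner_le_norm (score (f t) x - s t x) (relScore (f t) π x)
      show _ ≤ (1 / 2) * ‖s t x - score (f t) x‖ ^ 2 + (1 / 2) * ‖relScore (f t) π x‖ ^ 2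
      rw [norm_sub_rev (s t x)]
      nlinarith [sq_nonneg (‖score (f t) x - s t x‖ - ‖relScore (f t) π x‖)]
    exact ⟨by linarith, fun h => by linarith⟩
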